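/- Let $m,p,r$ be nonnegative integers. For $G:\mathbb C\to\mathbb C^{p\times m}$ put $$\|G\|_{\mathcal H_2}=\Big(\frac1{2\pi}\int_{-\infty}^{\infty}\|G(\imath\omega)\|_{\rm F}^2\,d\omega\Big)^{1/2}\in[0,\infty],$$ where $\|\cdot\|_{\rm F}$ is the Frobenius norm. A stable real system of dimension $n$ is a quadruple of real matrices $E,A\in\mathbb R^{n\times n}$, $B\in\mathbb R^{n\times m}$, $C\in\mathbb R^{p\times n}$ with $E$ nonsingular and all eigenvalues of the pencil $\lambda E-A$ in the open left half-plane; its transfer function is $C(sE-A)^{-1}B$. Let $H$ be a $p\times m$ matrix-valued function in the Hardy space $\mathcal H_2$ of the right half-plane: $H$ is analytic in $\{\operatorname{Re}s>0\}$, $\sup_{x>0}\int_{-\infty}^\infty\|H(x+\imath\omega)\|_{\rm F}^2\,d\omega<\infty$, and the value $H(\imath\omega)$ is the limit of $H(x+\imath\omega)$ as $x\to0^+$ for almost every $\omega\in\mathbb R$. Let $H$ be real, i.e. $H(\bar s)=\overline{H(s)}$ for $\operatorname{Re}s>0$. (The transfer function of every stable real system, of any dimension $n$, is of this kind.) Let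 $H_r(s)=C_r(sE_r-A_r)^{-1}B_r$ be the transfer function of a stable real system of dimension $r$ that is a best order-$r$ approximation of $H$ in the $\mathcal H_2$ norm, i.e. $\|H-H_r\|_{\mathcal H_2}\le\|H-\widetilde H_r\|_{\mathcal H_2}$ for the transfer function $\widetilde H_r$ of every stable real system of dimension $r$. Suppose that the poles $\lambda_1,\dots,\lambda_r\in\mathbb C$ (the eigenvalues of the pencil $\lambda E_r-A_r$) are distinct and that, with $c_i\in\mathbb C^p$ and $b_i\in\mathbb C^m$, $$H_r(s)=\sum_{i=1}^r\frac{c_ib_i^T}{s-\lambda_i}\qquad\text{for all } s\in\mathbb C \text{ with } \det(sE_r-A_r)\ne0 .$$ Then, for every $k=1,\dots,r$, $$H(-\lambda_k)b_k=H_r(-\lambda_k)b_k,\qquad c_k^TH(-\lambda_k)=c_k^TH_r(-\lambda_k),\qquad c_k^TH'(-\lambda_k)b_k=c_k^TH_r'(-\lambda_k)b_k .$$ -/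

import Mathlib

open scoped Matrix ENNReal Topology ComplexConjugate

noncomputable section

/-- A real, strictly proper linear time-invariant system of dimension `n`, with `m` inputs and
`p` outputs: `E x' = A x + B u`, `y = C x`. -/
structure LTISystem (n m p : ℕ) where
  E : Matrix (Fin n) (Fin n) ℝ
  A : Matrix (Fin n) (Fin n) ℝ
  B : Matrix (Fin n) (Fin m) ℝ
  C : Matrix (Fin p) (Fin n) ℝ

namespace LTISystem

variable {n m p : ℕ}

/-- The matrix pencil `s E - A` at a complex point `s`. -/
def pencil (S : LTISystem n m p) (s : ℂ) : Matrix (Fin n) (Fin n) ℂ :=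
  s • S.E.map Complex.ofReal - S.A.map Complex.ofReal

/-- The transfer function `C (s E - A)⁻¹ B`. -/
def transfer (S : LTISystem n m p) (s : ℂ) : Matrix (Fin p) (Fin m) ℂ :=
  S.C.map Complex.ofReal * (S.pencil s)⁻¹ * S.B.map Complex.ofReal

/-- The system is a stable system of ordinary differential equations: `E` is nonsingular and all
eigenvalues of the pencil `s E - A` lie in the open left half-plane. -/
structure IsStable (S : LTISystem n m p) : Prop where
  isUnit_det : IsUnit S.E.det
  re_neg : ∀ s : ℂ, (S.pencil s).det = 0 → s.re < 0

end LTISystem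

/-- The square of the Frobenius norm of a complex matrix, as an extended nonnegative real. -/
def frobeniusSq {m p : ℕ} (M : Matrix (Fin p) (Fin m) ℂ) : ℝ≥0∞ :=
  ∑ i, ∑ j, ‖M i j‖ₑ ^ 2

/-- The `H₂` norm `((1 / 2π) ∫ ‖G(iω)‖_F² dω)^(1/2)`, with values in `[0, ∞]`. -/
def h2Norm {m p : ℕ} (G : ℂ → Matrix (Fin p) (Fin m) ℂ) : ℝ≥0∞ :=
  (ENNReal.ofReal (1 / (2 * Real.pi)) *
    ∫⁻ ω : ℝ, frobeniusSq (G (Complex.I * (ω : ℂ)))) ^ (1 / 2 : ℝ)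

/-- `H` belongs to the Hardy space `H₂` of the right half-plane: it is analytic there, its
`L²` norms on the vertical lines to the right of the imaginary axis are uniformly bounded, and its
values on the imaginary axis are, almost everywhere, its boundary values. -/
structure MemH2 {m p : ℕ} (H : ℂ → Matrix (Fin p) (Fin m) ℂ) : Prop where
  differentiableOn : ∀ i j, DifferentiableOn ℂ (fun s => H s i j) {s : ℂ | 0 < s.re}
  bounded : ∃ K : ℝ≥0∞, K ≠ ∞ ∧ ∀ x : ℝ, 0 < x →
    ∫⁻ ω : ℝ, frobeniusSq (H ((x : ℂ) + Complex.I * (ω : ℂ))) ≤ K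
  boundary : ∀ i j, ∀ᵐ ω : ℝ, Filter.Tendsto
    (fun x : ℝ => H ((x : ℂ) + Complex.I * (ω : ℂ)) i j) (𝓝[>] 0)
    (𝓝 (H (Complex.I * (ω : ℂ)) i j))

/-- `H` is the transfer function of a real system: `H(conj s) = conj H(s)` in the right
half-plane. -/
def IsRealTransfer {m p : ℕ} (H : ℂ → Matrix (Fin p) (Fin m) ℂ) : Prop :=
  ∀ s : ℂ, 0 < s.re → H (conj s) = (H s).map conj

/-- The stable system `S` of dimension `r` is a best order-`r` approximation of `H` in the
`H₂` norm. -/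
def IsBestH2Approx {r m p : ℕ} (H : ℂ → Matrix (Fin p) (Fin m) ℂ) (S : LTISystem r m p) : Prop :=
  S.IsStable ∧ ∀ T : LTISystem r m p, T.IsStable →
    h2Norm (fun s => H s - S.transfer s) ≤ h2Norm (fun s => H s - T.transfer s)

/-- The entrywise complex derivative of a matrix-valued function. -/
def matrixDeriv {m p : ℕ} (H : ℂ → Matrix (Fin p) (Fin m) ℂ) (s : ℂ) :
    Matrix (Fin p) (Fin m) ℂ :=
  Matrix.of fun i j => deriv (fun z => H z i j) s

end

/-! The transfer function of every stable system is real and belongs to `H₂`. -/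

namespace LTISystem

variable {n m p : ℕ}

theorem IsStable.isUnit_pencil_det {S : LTISystem n m p} (hS : S.IsStable) {s : ℂ}
    (hs : 0 ≤ s.re) : IsUnit (S.pencil s).det := by
  rw [isUnit_iff_ne_zero]
  intro h
  exact absurd (hS.re_neg s h) (not_lt.mpr hs)

theorem IsStable.isRealTransfer {S : LTISystem n m p} (_hS : S.IsStable) :
    IsRealTransfer S.transfer := by
  intro s _
  have hr : ∀ {a b : ℕ} (M : Matrix (Fin a) (Fin b) ℝ),
      (M.map Complex.ofReal).map (starRingEnd ℂ) = M.map Complex.ofReal := by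
    intro a b M
    ext i j
    simp
  have hp : S.pencil (conj s) = (S.pencil s).map (starRingEnd ℂ) := by
    ext i j
    simp [pencil]
  have hinv : ((S.pencil s).map (starRingEnd ℂ))⁻¹ = ((S.pencil s)⁻¹).map (starRingEnd ℂ) := by
    rw [Matrix.inv_def, Matrix.inv_def]
    have h1 := RingHom.map_det (starRingEnd ℂ) (S.pencil s)
    have h2 := RingHom.map_adjugate (starRingEnd ℂ) (S.pencil s)
    rw [RingHom.mapMatrix_apply] at h1
    rw [RingHom.mapMatrix_apply, RingHom.mapMatrix_apply] at h2
    rw [← h1, ← h2]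
    ext i j
    simp
  unfold transfer
  rw [hp, hinv, Matrix.map_mul, Matrix.map_mul, hr, hr]

theorem differentiable_pencil (S : LTISystem n m p) (i j : Fin n) :
    Differentiable ℂ fun s => S.pencil s i j := by
  simp only [pencil, Matrix.sub_apply, Matrix.smul_apply, smul_eq_mul]
  fun_prop

theorem differentiable_det {k : ℕ} {M : ℂ → Matrix (Fin k) (Fin k) ℂ}
    (hM : ∀ i j, Differentiable ℂ fun s => M s i j) : Differentiable ℂ fun s => (M s).det := by
  simp only [Matrix.det_apply]
  refine Differentiable.fun_sum fun σ _ => ?_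
  refine Differentiable.const_smul ?_ _
  exact Differentiable.fun_finsetProd fun i _ => hM _ _

theorem differentiable_adjugate (S : LTISystem n m p) (i j : Fin n) :
    Differentiable ℂ fun s => (S.pencil s).adjugate i j := by
  simp only [Matrix.adjugate_apply]
  refine differentiable_det fun a b => ?_
  by_cases h : a = j
  · subst h
    simp
  · simp only [Matrix.updateRow_ne h]
    exact S.differentiable_pencil a b

theorem IsStable.differentiableAt {S : LTISystem n m p} (hS : S.IsStable) {s : ℂ}
    (hs : 0 ≤ s.re) (i : Fin p) (j : Fin m) :
    DifferentiableAt ℂ (fun z => S.transfer z i j) s := by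
  have hd : (S.pencil s).det ≠ 0 := (hS.isUnit_pencil_det hs).ne_zero
  have hdet : Differentiable ℂ fun z => (S.pencil z).det :=
    differentiable_det S.differentiable_pencil
  simp only [transfer, Matrix.mul_apply, Matrix.inv_def, Ring.inverse_eq_inv', Matrix.smul_apply,
    smul_eq_mul]
  refine DifferentiableAt.fun_sum fun a _ => DifferentiableAt.mul_const ?_ _
  refine DifferentiableAt.fun_sum fun b _ => DifferentiableAt.const_mul ?_ _
  exact (DifferentiableAt.inv (hdet s) hd).mul (S.differentiable_adjugate b a s)

theorem IsStable.exists_bound {S : LTISystem n m p} (hS : S.IsStable) (i : Fin p) (j : Fin m) :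
    ∃ K : ℝ, ∀ s : ℂ, 0 ≤ s.re → ‖S.transfer s i j‖ ^ 2 ≤ K * (1 + ‖s‖ ^ 2)⁻¹ := by
  set E : Matrix (Fin n) (Fin n) ℂ := S.E.map Complex.ofReal with hE
  set A : Matrix (Fin n) (Fin n) ℂ := S.A.map Complex.ofReal with hA
  have hEdet : E.det ≠ 0 := by
    have h1 := RingHom.map_det Complex.ofRealHom S.E
    rw [RingHom.mapMatrix_apply] at h1
    have h2 : E.det = ((S.E.det : ℝ) : ℂ) := h1.symm
    rw [h2]
    exact_mod_cast hS.isUnit_det.ne_zero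
  let g : ℂ → ℂ := fun t =>
    (S.C.map Complex.ofReal * (E - t • A)⁻¹ * S.B.map Complex.ofReal) i j
  have hM : Continuous fun t : ℂ => E - t • A := by fun_prop
  have hg : ContinuousAt g 0 := by
    have hinv : ContinuousAt (fun t : ℂ => (E - t • A)⁻¹) 0 := by
      simp only [Matrix.inv_def, Ring.inverse_eq_inv']
      have hd : ContinuousAt (fun t : ℂ => ((E - t • A).det)⁻¹) 0 :=
        hM.matrix_det.continuousAt.inv₀ (by simpa using hEdet)
      have ha : ContinuousAt (fun t : ℂ => (E - t • A).adjugate) 0 :=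
        hM.matrix_adjugate.continuousAt
      exact hd.smul ha
    have h1 : Continuous fun M : Matrix (Fin n) (Fin n) ℂ =>
        (S.C.map Complex.ofReal * M * S.B.map Complex.ofReal) i j :=
      ((continuous_const.matrix_mul continuous_id).matrix_mul continuous_const).matrix_elem i j
    exact h1.continuousAt.comp hinv
  have hrel : ∀ s : ℂ, s ≠ 0 → S.transfer s i j = s⁻¹ * g s⁻¹ := by
    intro s hs
    have hp : S.pencil s = s • (E - s⁻¹ • A) := by
      rw [smul_sub, smul_smul, mul_inv_cancel₀ hs, one_smul]
      rfl
    have hpi : (S.pencil s)⁻¹ = s⁻¹ • (E - s⁻¹ • A)⁻¹ := by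
      rw [hp]
      by_cases hu : IsUnit (E - s⁻¹ • A).det
      · refine Matrix.inv_eq_left_inv ?_
        rw [Matrix.smul_mul, Matrix.mul_smul, smul_smul, inv_mul_cancel₀ hs, one_smul,
          Matrix.nonsing_inv_mul _ hu]
      · have hu2 : ¬ IsUnit (s • (E - s⁻¹ • A)).det := by
          rw [Matrix.det_smul, isUnit_iff_ne_zero] at *
          simp only [ne_eq, not_not] at hu
          simp [hu]
        rw [Matrix.nonsing_inv_apply_not_isUnit _ hu, Matrix.nonsing_inv_apply_not_isUnit _ hu2,
          smul_zero]
    simp only [transfer, hpi, g, Matrix.mul_smul, Matrix.smul_mul, Matrix.smul_apply, smul_eq_mul]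
  have hev : ∀ᶠ t in 𝓝 (0 : ℂ), ‖g t‖ < ‖g 0‖ + 1 :=
    hg.norm.eventually (gt_mem_nhds (lt_add_one _))
  obtain ⟨ε, hε, hball⟩ := Metric.eventually_nhds_iff.mp hev
  have hcont : ContinuousOn (fun s => S.transfer s i j)
      (Metric.closedBall 0 ε⁻¹ ∩ {s : ℂ | 0 ≤ s.re}) := fun s hs =>
    (hS.differentiableAt hs.2 i j).continuousAt.continuousWithinAt
  have hcomp : IsCompact (Metric.closedBall (0 : ℂ) ε⁻¹ ∩ {s : ℂ | 0 ≤ s.re}) :=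
    (isCompact_closedBall _ _).inter_right (isClosed_le continuous_const Complex.continuous_re)
  obtain ⟨K₁, hK₁⟩ := hcomp.exists_bound_of_continuousOn hcont
  refine ⟨K₁ ^ 2 * (1 + ε⁻¹ ^ 2) + (‖g 0‖ + 1) ^ 2 * (ε ^ 2 + 1), fun s hs => ?_⟩
  have hpos : 0 < 1 + ‖s‖ ^ 2 := by positivity
  rw [← div_eq_mul_inv, le_div_iff₀ hpos]
  by_cases hsb : ‖s‖ ≤ ε⁻¹
  · have h1 := hK₁ s ⟨by simpa using hsb, hs⟩
    have h2 : ‖S.transfer s i j‖ ^ 2 ≤ K₁ ^ 2 := by gcongr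
    have h3 : ‖s‖ ^ 2 ≤ ε⁻¹ ^ 2 := by gcongr
    have h4 : ‖S.transfer s i j‖ ^ 2 * (1 + ‖s‖ ^ 2) ≤ K₁ ^ 2 * (1 + ε⁻¹ ^ 2) := by gcongr
    have h5 : 0 ≤ (‖g 0‖ + 1) ^ 2 * (ε ^ 2 + 1) := by positivity
    linarith
  · push Not at hsb
    have hs0 : 0 < ‖s‖ := lt_trans (inv_pos.mpr hε) hsb
    have hsi : ‖s‖⁻¹ < ε := inv_lt_of_inv_lt₀ hε hsb
    have h1 : ‖g s⁻¹‖ ≤ ‖g 0‖ + 1 := (hball (by simpa using hsi)).le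
    have h2 : ‖S.transfer s i j‖ ^ 2 * (1 + ‖s‖ ^ 2) = ‖g s⁻¹‖ ^ 2 * (‖s‖⁻¹ ^ 2 + 1) := by
      rw [hrel s (norm_pos_iff.mp hs0), norm_mul, norm_inv]
      field_simp
    rw [h2]
    have h3 : ‖g s⁻¹‖ ^ 2 * (‖s‖⁻¹ ^ 2 + 1) ≤ (‖g 0‖ + 1) ^ 2 * (ε ^ 2 + 1) := by gcongr
    have h5 : 0 ≤ K₁ ^ 2 * (1 + ε⁻¹ ^ 2) := by positivity
    linarith

theorem IsStable.memH2 {S : LTISystem n m p} (hS : S.IsStable) : MemH2 S.transfer := by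
  choose K hK using fun (i : Fin p) (j : Fin m) => hS.exists_bound i j
  have hK0 : ∀ i j, 0 ≤ K i j := fun i j => by
    have := (sq_nonneg _).trans (hK i j 0 (by simp))
    simpa using this
  let L : ℝ := ∑ i, ∑ j, K i j
  refine ⟨fun i j s hs => (hS.differentiableAt (le_of_lt hs) i j).differentiableWithinAt, ?_, ?_⟩
  · refine ⟨∫⁻ ω : ℝ, ENNReal.ofReal (L * (1 + ω ^ 2)⁻¹), ?_, fun x hx => ?_⟩
    · exact (integrable_inv_one_add_sq.const_mul L).lintegral_lt_top.ne
    · refine MeasureTheory.lintegral_mono fun ω => ?_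
      have hre : ((x : ℂ) + Complex.I * (ω : ℂ)).re = x := by simp
      have him : ((x : ℂ) + Complex.I * (ω : ℂ)).im = ω := by simp
      have hn : ω ^ 2 ≤ ‖(x : ℂ) + Complex.I * (ω : ℂ)‖ ^ 2 := by
        rw [Complex.sq_norm, Complex.normSq_apply, hre, him]
        nlinarith [sq_nonneg x]
      have hterm : ∀ i j, ‖S.transfer ((x : ℂ) + Complex.I * (ω : ℂ)) i j‖ₑ ^ 2 ≤
          ENNReal.ofReal (K i j * (1 + ω ^ 2)⁻¹) := by
        intro i j
        rw [← ofReal_norm, ← ENNReal.ofReal_pow (norm_nonneg _)]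
        refine ENNReal.ofReal_le_ofReal ((hK i j _ (by rw [hre]; exact hx.le)).trans ?_)
        have := hK0 i j
        gcongr
      have hnn : ∀ i j, 0 ≤ K i j * (1 + ω ^ 2)⁻¹ := fun i j =>
        mul_nonneg (hK0 i j) (by positivity)
      calc frobeniusSq (S.transfer ((x : ℂ) + Complex.I * (ω : ℂ)))
          ≤ ∑ i, ∑ j, ENNReal.ofReal (K i j * (1 + ω ^ 2)⁻¹) :=
            Finset.sum_le_sum fun i _ => Finset.sum_le_sum fun j _ => hterm i j
        _ = ENNReal.ofReal (L * (1 + ω ^ 2)⁻¹) := by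
            simp only [L, Finset.sum_mul]
            rw [ENNReal.ofReal_sum_of_nonneg fun i _ => Finset.sum_nonneg fun j _ => hnn i j]
            exact Finset.sum_congr rfl fun i _ =>
              (ENNReal.ofReal_sum_of_nonneg fun j _ => hnn i j).symm
  · refine fun i j => Filter.Eventually.of_forall fun ω => ?_
    have h1 : ContinuousAt (fun z => S.transfer z i j) (((0 : ℝ) : ℂ) + Complex.I * (ω : ℂ)) :=
      (hS.differentiableAt (by simp) i j).continuousAt
    have h2 : ContinuousAt (fun x : ℝ => (x : ℂ) + Complex.I * (ω : ℂ)) 0 := by fun_prop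
    have h3 := (ContinuousAt.comp (f := fun x : ℝ => (x : ℂ) + Complex.I * (ω : ℂ))
      (g := fun z => S.transfer z i j) h1 h2).tendsto
    simp only [Function.comp_def, Complex.ofReal_zero, zero_add] at h3
    exact h3.mono_left nhdsWithin_le_nhds

end LTISystem

open MeasureTheory Filter

/-! Write `P(s) = sE - A` for the pencil of the best approximation and `e = H - H_r` for the error.
Moving the real matrices of the system in a real direction cannot decrease the squared distance to
`H`, so `e` is orthogonal in `L²` of the imaginary axis to every tangent direction: `C P⁻¹ Z`
(moving `B`), `Z P⁻¹ B` (moving `C`) and `C P⁻¹ Z P⁻¹ B` (moving `A`). For real functions the inner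
product is the bilinear pairing `∑ ∫ eᵢⱼ(-iω) Gᵢⱼ(iω) dω`, so orthogonality extends to complex `Z`
(`axisPairing_input`, `axisPairing_output`, `axisPairing_state`).

Rank-one `Z` built from right and left eigenvectors `x`, `y` at `λ` turn these directions into `(s -
λ)⁻¹ (Cx) vᵀ`, `(s - λ)⁻¹ u (yB)` and `(s - λ)⁻² (Cx)(yB)`. Pairing with a simple or double pole at
`λ` is a Cauchy integral, which evaluates `e` or its derivative at `-λ`. This gives the three
conditions with `Cx` and `yB` in place of `c` and `b`. Comparing residues yields `c bᵀ = (Cx)(yB)`,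
so if this matrix is nonzero, `c` and `b` are multiples of `Cx` and `yB`.

If the residue vanishes, one of `c`, `b` may still be arbitrary, and the error itself must vanish at
`-λ`. In that case `Cx = 0` or `yB = 0`, and `B` or `C` can be changed without changing the transfer
function. Each changed system is again a best approximation, and its own conditions force `e(-λ) =
0`.

The analytic input is Cauchy's formula on the imaginary axis for functions with only almost
everywhere boundary values. It is proved on lines inside the half-plane by shifting contours
(`integral_vertical_eq`), then carried to the axis by weak convergence
(`tendsto_integral_mul_of_ae_tendsto`). -/

/-! ### Square-integrable functions: Fatou's lemma and weak convergence. -/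

theorem memLp_two_of_lintegral_sq_ne_top {α : Type*} [MeasurableSpace α] {μ : Measure α}
    {f : α → ℂ} (hf : AEStronglyMeasurable f μ) (h : ∫⁻ x, ‖f x‖ₑ ^ 2 ∂μ ≠ ∞) :
    MemLp f 2 μ := by
  rw [memLp_two_iff_integrable_sq_norm hf]
  refine ⟨hf.norm.pow 2, ?_⟩
  rw [hasFiniteIntegral_iff_enorm]
  refine lt_of_le_of_lt (le_of_eq ?_) h.lt_top
  refine lintegral_congr fun x => ?_
  simp [enorm_pow]

theorem ofReal_integral_sq_norm_eq {α : Type*} [MeasurableSpace α] {μ : Measure α}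
    {f : α → ℂ} (hf : MemLp f 2 μ) :
    ENNReal.ofReal (∫ x, ‖f x‖ ^ 2 ∂μ) = ∫⁻ x, ‖f x‖ₑ ^ 2 ∂μ := by
  rw [ofReal_integral_eq_lintegral_ofReal]
  · refine lintegral_congr fun x => ?_
    rw [ENNReal.ofReal_pow (norm_nonneg _), ofReal_norm]
  · exact (memLp_two_iff_integrable_sq_norm hf.1).1 hf
  · exact Eventually.of_forall fun x => by positivity

theorem integral_sq_norm_le_toReal {α : Type*} [MeasurableSpace α] {μ : Measure α}
    {f : α → ℂ} {K : ℝ≥0∞} (hf : MemLp f 2 μ) (hK : K ≠ ∞) (h : ∫⁻ x, ‖f x‖ₑ ^ 2 ∂μ ≤ K) :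
    ∫ x, ‖f x‖ ^ 2 ∂μ ≤ K.toReal := by
  rw [← ofReal_integral_sq_norm_eq hf] at h
  exact (ENNReal.ofReal_le_iff_le_toReal hK).1 h

/-- Fatou's lemma for squares of norms. -/
theorem lintegral_sq_le_of_ae_tendsto {α : Type*} [MeasurableSpace α] {μ : Measure α}
    {f : ℕ → α → ℂ} {f₀ : α → ℂ} {K : ℝ≥0∞} (hf : ∀ n, AEStronglyMeasurable (f n) μ)
    (hK : ∀ n, ∫⁻ x, ‖f n x‖ₑ ^ 2 ∂μ ≤ K)
    (hlim : ∀ᵐ x ∂μ, Tendsto (fun n => f n x) atTop (𝓝 (f₀ x))) :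
    ∫⁻ x, ‖f₀ x‖ₑ ^ 2 ∂μ ≤ K := by
  calc ∫⁻ x, ‖f₀ x‖ₑ ^ 2 ∂μ = ∫⁻ x, liminf (fun n => ‖f n x‖ₑ ^ 2) atTop ∂μ := by
        refine lintegral_congr_ae ?_
        filter_upwards [hlim] with x hx
        exact (((ENNReal.continuous_pow 2).tendsto _).comp hx.enorm).liminf_eq.symm
    _ ≤ liminf (fun n => ∫⁻ x, ‖f n x‖ₑ ^ 2 ∂μ) atTop :=
        lintegral_liminf_le' fun n => (hf n).enorm.pow_const 2
    _ ≤ liminf (fun _ : ℕ => K) atTop := liminf_le_liminf (Eventually.of_forall hK)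
    _ = K := by simp

/-- A bounded sequence in `L²` that converges almost everywhere converges weakly. -/
theorem tendsto_integral_mul_of_ae_tendsto {α : Type*} [MeasurableSpace α] {μ : Measure α}
    {f : ℕ → α → ℂ} {f₀ g : α → ℂ} {K : ℝ≥0∞} (hf : ∀ n, AEStronglyMeasurable (f n) μ)
    (hKtop : K ≠ ∞) (hK : ∀ n, ∫⁻ x, ‖f n x‖ₑ ^ 2 ∂μ ≤ K)
    (hlim : ∀ᵐ x ∂μ, Tendsto (fun n => f n x) atTop (𝓝 (f₀ x))) (hg : MemLp g 2 μ) :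
    Tendsto (fun n => ∫ x, f n x * g x ∂μ) atTop (𝓝 (∫ x, f₀ x * g x ∂μ)) := by
  have hf₀ : AEStronglyMeasurable f₀ μ := aestronglyMeasurable_of_tendsto_ae atTop hf hlim
  have hK₀ := lintegral_sq_le_of_ae_tendsto hf hK hlim
  have hmem : ∀ n, MemLp (f n) 2 μ := fun n =>
    memLp_two_of_lintegral_sq_ne_top (hf n) (ne_top_of_le_ne_top hKtop (hK n))
  have hmem₀ : MemLp f₀ 2 μ :=
    memLp_two_of_lintegral_sq_ne_top hf₀ (ne_top_of_le_ne_top hKtop hK₀)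
  have hsq : ∀ {u : α → ℂ}, MemLp u 2 μ → Integrable (fun x => ‖u x‖ ^ 2) μ := fun hu =>
    (memLp_two_iff_integrable_sq_norm hu.1).1 hu
  have hd : ∀ n, ∫ x, ‖f n x - f₀ x‖ ^ 2 ∂μ ≤ 4 * K.toReal := by
    intro n
    calc ∫ x, ‖f n x - f₀ x‖ ^ 2 ∂μ ≤ ∫ x, (2 * ‖f n x‖ ^ 2 + 2 * ‖f₀ x‖ ^ 2) ∂μ := by
          refine integral_mono (hsq ((hmem n).sub hmem₀))
            (((hsq (hmem n)).const_mul 2).add ((hsq hmem₀).const_mul 2)) fun x => ?_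
          have := norm_sub_le (f n x) (f₀ x)
          dsimp only
          nlinarith [sq_nonneg (‖f n x‖ - ‖f₀ x‖), norm_nonneg (f n x - f₀ x)]
      _ = 2 * ∫ x, ‖f n x‖ ^ 2 ∂μ + 2 * ∫ x, ‖f₀ x‖ ^ 2 ∂μ := by
          rw [integral_add ((hsq (hmem n)).const_mul 2) ((hsq hmem₀).const_mul 2),
            integral_const_mul, integral_const_mul]
      _ ≤ 4 * K.toReal := by
          linarith [integral_sq_norm_le_toReal (hmem n) hKtop (hK n),
            integral_sq_norm_le_toReal hmem₀ hKtop hK₀]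
  have hint : ∀ n, Integrable (fun x => f n x * g x) μ := fun n => (hmem n).integrable_mul hg
  have hint₀ : Integrable (fun x => f₀ x * g x) μ := hmem₀.integrable_mul hg
  rw [Metric.tendsto_atTop']
  intro ε hε
  set C := 4 * K.toReal with hC
  have hC0 : 0 ≤ C := by positivity
  -- The integrand is split according to whether `‖f n - f₀‖ ≤ M ‖g‖`. There `‖f n - f₀‖ ‖g‖` is
  -- dominated by `M ‖g‖²`; elsewhere it is at most `‖f n - f₀‖² / M`, whose integral is at most `C
  -- / M`. This `M` makes the latter less than `ε / 2`.
  set M : ℝ := 2 * (C + 1) / ε with hM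
  have hM0 : 0 < M := by positivity
  have hCM : C / M < ε / 2 := by
    rw [div_lt_iff₀ hM0, hM]
    have : ε / 2 * (2 * (C + 1) / ε) = C + 1 := by field_simp
    linarith
  have hmin : Tendsto (fun n => ∫ x, min ‖f n x - f₀ x‖ (M * ‖g x‖) * ‖g x‖ ∂μ) atTop
      (𝓝 (∫ _ : α, (0 : ℝ) ∂μ)) := by
    refine tendsto_integral_of_dominated_convergence (fun x => M * ‖g x‖ ^ 2) (fun n => ?_)
      ((hsq hg).const_mul M) (fun n => Eventually.of_forall fun x => ?_) ?_
    · exact (((hf n).sub hf₀).norm.inf (hg.1.norm.const_mul M)).mul hg.1.norm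
    · have h0 : 0 ≤ min ‖f n x - f₀ x‖ (M * ‖g x‖) := le_min (norm_nonneg _) (by positivity)
      rw [Real.norm_of_nonneg (by positivity)]
      have := min_le_right ‖f n x - f₀ x‖ (M * ‖g x‖)
      nlinarith [norm_nonneg (g x)]
    · filter_upwards [hlim] with x hx
      have h1 : Tendsto (fun n => ‖f n x - f₀ x‖) atTop (𝓝 0) := by
        simpa using (hx.sub_const (f₀ x)).norm
      have h2 := (h1.min (tendsto_const_nhds (x := M * ‖g x‖))).mul_const ‖g x‖
      rwa [min_eq_left (by positivity), zero_mul] at h2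
  rw [integral_zero] at hmin
  obtain ⟨N, hN⟩ := (hmin.eventually (gt_mem_nhds (half_pos hε))).exists_forall_of_atTop
  refine ⟨N, fun n hn => ?_⟩
  rw [dist_eq_norm, ← integral_sub (hint n) hint₀]
  have hsqd : Integrable (fun x => ‖f n x - f₀ x‖ ^ 2) μ := hsq ((hmem n).sub hmem₀)
  have hmint : Integrable (fun x => min ‖f n x - f₀ x‖ (M * ‖g x‖) * ‖g x‖) μ := by
    refine ((hsq hg).const_mul M).mono'
      ((((hf n).sub hf₀).norm.inf (hg.1.norm.const_mul M)).mul hg.1.norm)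
      (Eventually.of_forall fun x => ?_)
    have h0 : 0 ≤ min ‖f n x - f₀ x‖ (M * ‖g x‖) := le_min (norm_nonneg _) (by positivity)
    rw [Real.norm_of_nonneg (by positivity)]
    have := min_le_right ‖f n x - f₀ x‖ (M * ‖g x‖)
    nlinarith [norm_nonneg (g x)]
  calc ‖∫ x, (f n x * g x - f₀ x * g x) ∂μ‖ ≤
        ∫ x, (min ‖f n x - f₀ x‖ (M * ‖g x‖) * ‖g x‖ + ‖f n x - f₀ x‖ ^ 2 / M) ∂μ := by
        refine norm_integral_le_of_norm_le (hmint.add (hsqd.div_const M))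
          (Eventually.of_forall fun x => ?_)
        rw [← sub_mul, norm_mul]
        rcases le_total ‖f n x - f₀ x‖ (M * ‖g x‖) with h | h
        · rw [min_eq_left h]
          have : 0 ≤ ‖f n x - f₀ x‖ ^ 2 / M := by positivity
          linarith
        · rw [min_eq_right h]
          have h1 : ‖f n x - f₀ x‖ * ‖g x‖ ≤ ‖f n x - f₀ x‖ ^ 2 / M := by
            rw [le_div_iff₀ hM0]
            nlinarith [norm_nonneg (f n x - f₀ x)]
          have : 0 ≤ M * ‖g x‖ * ‖g x‖ := by positivity
          linarith
    _ = ∫ x, min ‖f n x - f₀ x‖ (M * ‖g x‖) * ‖g x‖ ∂μ + (∫ x, ‖f n x - f₀ x‖ ^ 2 ∂μ) / M := by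
        rw [integral_add hmint (hsqd.div_const M), integral_div]
    _ ≤ ∫ x, min ‖f n x - f₀ x‖ (M * ‖g x‖) * ‖g x‖ ∂μ + C / M := by
        gcongr
        exact hd n
    _ < ε := by linarith [hN n (le_of_lt hn)]

/-! ### The Cauchy kernel on the imaginary axis. -/

theorem sq_norm_sub_I_mul (w : ℂ) (ω : ℝ) :
    ‖w - Complex.I * (ω : ℂ)‖ ^ 2 = w.re ^ 2 + (ω - w.im) ^ 2 := by
  rw [Complex.sq_norm, Complex.normSq_apply]
  simp
  ring

theorem inv_sq_add_sub_sq_eq {a : ℝ} (ha : a ≠ 0) (b : ℝ) :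
    (fun ω : ℝ => (a ^ 2 + (ω - b) ^ 2)⁻¹) =
      fun ω : ℝ => a⁻¹ ^ 2 * (1 + (a⁻¹ * (ω - b)) ^ 2)⁻¹ := by
  funext ω
  have h1 : 0 < a ^ 2 + (ω - b) ^ 2 := by positivity
  field_simp

theorem integrable_inv_sq_add_sub_sq {a : ℝ} (ha : a ≠ 0) (b : ℝ) :
    Integrable fun ω : ℝ => (a ^ 2 + (ω - b) ^ 2)⁻¹ := by
  rw [inv_sq_add_sub_sq_eq ha b]
  exact (((integrable_inv_one_add_sq).comp_mul_left' (inv_ne_zero ha)).comp_sub_right b).const_mul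
    _

theorem integral_inv_sq_add_sub_sq {a : ℝ} (ha : a ≠ 0) (b : ℝ) :
    ∫ ω : ℝ, (a ^ 2 + (ω - b) ^ 2)⁻¹ = Real.pi / |a| := by
  rw [inv_sq_add_sub_sq_eq ha b, integral_const_mul,
    integral_sub_right_eq_self (fun ω : ℝ => (1 + (a⁻¹ * ω) ^ 2)⁻¹) b,
    Measure.integral_comp_mul_left (fun ω : ℝ => (1 + ω ^ 2)⁻¹) a⁻¹, integral_univ_inv_one_add_sq]
  have ha' : |a| ≠ 0 := abs_ne_zero.mpr ha
  rw [inv_inv, smul_eq_mul, ← sq_abs, abs_inv]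
  field_simp

theorem sub_I_mul_ne_zero {w : ℂ} (hw : w.re ≠ 0) (ω : ℝ) : w - Complex.I * (ω : ℂ) ≠ 0 := by
  intro h
  apply hw
  have := congrArg Complex.re h
  simpa using this

theorem continuous_cauchy_kernel {w : ℂ} (hw : w.re ≠ 0) :
    Continuous fun ω : ℝ => (w - Complex.I * (ω : ℂ))⁻¹ :=
  Continuous.inv₀ (by fun_prop) (sub_I_mul_ne_zero hw)

theorem memLp_cauchy_kernel {w : ℂ} (hw : w.re ≠ 0) :
    MemLp (fun ω : ℝ => (w - Complex.I * (ω : ℂ))⁻¹) 2 volume := by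
  rw [memLp_two_iff_integrable_sq_norm (continuous_cauchy_kernel hw).aestronglyMeasurable]
  simp only [norm_inv, inv_pow, sq_norm_sub_I_mul]
  exact integrable_inv_sq_add_sub_sq hw _

/-! ### Contour shifting for functions analytic across the imaginary axis. -/

/-- Otherwise `S ≥ ε` on a half-line and the integral is infinite. This supplies the heights at
which to close the contours. -/
theorem frequently_lt_of_lintegral_ne_top {S : ℝ → ℝ≥0∞} (hS : ∫⁻ R, S R ≠ ∞) {ε : ℝ≥0∞}
    (hε : ε ≠ 0) : ∃ᶠ R in atTop, S R < ε := by
  intro h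
  obtain ⟨R₀, hR₀⟩ := h.exists_forall_of_atTop
  refine hS (top_le_iff.1 ?_)
  calc (∞ : ℝ≥0∞) = ∫⁻ _ in Set.Ici R₀, ε := by simp [hε]
    _ ≤ ∫⁻ R in Set.Ici R₀, S R :=
        setLIntegral_mono' measurableSet_Ici fun R hR => not_lt.1 (hR₀ R hR)
    _ ≤ ∫⁻ R, S R := setLIntegral_le_lintegral _ _

section Strip

variable {F : ℂ → ℂ} {δ : ℝ} {K : ℝ≥0∞}

theorem continuous_vertical_line (hδ : 0 < δ) (hF : DifferentiableOn ℂ F {s | -δ < s.re})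
    {x : ℝ} (hx : 0 ≤ x) : Continuous fun ω : ℝ => F ((x : ℂ) + Complex.I * (ω : ℂ)) := by
  refine hF.continuousOn.comp_continuous (by fun_prop) fun ω => ?_
  simp
  linarith

theorem memLp_vertical_line (hδ : 0 < δ) (hF : DifferentiableOn ℂ F {s | -δ < s.re})
    (hKtop : K ≠ ∞)
    (hK : ∀ x : ℝ, 0 ≤ x → ∫⁻ ω : ℝ, ‖F ((x : ℂ) + Complex.I * (ω : ℂ))‖ₑ ^ 2 ≤ K)
    {x : ℝ} (hx : 0 ≤ x) :
    MemLp (fun ω : ℝ => F ((x : ℂ) + Complex.I * (ω : ℂ))) 2 volume :=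
  memLp_two_of_lintegral_sq_ne_top (continuous_vertical_line hδ hF hx).aestronglyMeasurable
    (ne_top_of_le_ne_top hKtop (hK x hx))

/-- On a strip of finite width, the `L²` norm over horizontal sections becomes small. -/
theorem frequently_lintegral_horizontal_lt (hδ : 0 < δ)
    (hF : DifferentiableOn ℂ F {s | -δ < s.re}) (hKtop : K ≠ ∞)
    (hK : ∀ x : ℝ, 0 ≤ x → ∫⁻ ω : ℝ, ‖F ((x : ℂ) + Complex.I * (ω : ℂ))‖ₑ ^ 2 ≤ K)
    (X : ℝ) {ε : ℝ≥0∞} (hε : ε ≠ 0) :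
    ∃ᶠ R : ℝ in atTop, ∫⁻ σ in Set.Ioc 0 X, (‖F ((σ : ℂ) + Complex.I * (R : ℂ))‖ₑ ^ 2 +
      ‖F ((σ : ℂ) + Complex.I * ((-R : ℝ) : ℂ))‖ₑ ^ 2) < ε := by
  refine frequently_lt_of_lintegral_ne_top (ne_top_of_le_ne_top (b := 2 * K * ENNReal.ofReal X)
    (by finiteness) ?_) hε
  -- Clamping the real part at `0` gives a function continuous on the whole plane, hence jointly
  -- measurable as Tonelli's theorem requires.
  have hG : Continuous fun q : ℝ × ℝ => F (((max q.1 0 : ℝ) : ℂ) + Complex.I * (q.2 : ℂ)) := by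
    refine hF.continuousOn.comp_continuous (by fun_prop) fun q => ?_
    have : 0 ≤ max q.1 0 := le_max_right _ _
    simp only [Set.mem_ofPred_eq, Complex.add_re, Complex.ofReal_re, Complex.mul_re, Complex.I_re,
      Complex.I_im, Complex.ofReal_im]
    linarith
  have hG' : Continuous fun q : ℝ × ℝ =>
      F (((max q.1 0 : ℝ) : ℂ) + Complex.I * ((-q.2 : ℝ) : ℂ)) :=
    hG.comp (f := fun q : ℝ × ℝ => (q.1, -q.2)) (by fun_prop)
  have hmeas : Measurable fun q : ℝ × ℝ =>
      ‖F (((max q.2 0 : ℝ) : ℂ) + Complex.I * (q.1 : ℂ))‖ₑ ^ 2 +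
        ‖F (((max q.2 0 : ℝ) : ℂ) + Complex.I * ((-q.1 : ℝ) : ℂ))‖ₑ ^ 2 :=
    (((hG.measurable.enorm.pow_const 2).add (hG'.measurable.enorm.pow_const 2)).comp
      measurable_swap :)
  calc ∫⁻ R : ℝ, ∫⁻ σ in Set.Ioc 0 X, (‖F ((σ : ℂ) + Complex.I * (R : ℂ))‖ₑ ^ 2 +
        ‖F ((σ : ℂ) + Complex.I * ((-R : ℝ) : ℂ))‖ₑ ^ 2)
      = ∫⁻ R : ℝ, ∫⁻ σ in Set.Ioc 0 X,
        (‖F (((max σ 0 : ℝ) : ℂ) + Complex.I * (R : ℂ))‖ₑ ^ 2 +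
        ‖F (((max σ 0 : ℝ) : ℂ) + Complex.I * ((-R : ℝ) : ℂ))‖ₑ ^ 2) := by
        refine lintegral_congr fun R => setLIntegral_congr_fun measurableSet_Ioc fun σ hσ => ?_
        simp only [max_eq_left hσ.1.le]
    _ = ∫⁻ σ in Set.Ioc 0 X, ∫⁻ R : ℝ,
        (‖F (((max σ 0 : ℝ) : ℂ) + Complex.I * (R : ℂ))‖ₑ ^ 2 +
        ‖F (((max σ 0 : ℝ) : ℂ) + Complex.I * ((-R : ℝ) : ℂ))‖ₑ ^ 2) :=
        lintegral_lintegral_swap hmeas.aemeasurable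
    _ ≤ ∫⁻ σ in Set.Ioc 0 X, 2 * K := by
        refine lintegral_mono fun σ => ?_
        have hc := continuous_vertical_line hδ hF (le_max_right σ 0)
        rw [lintegral_add_left (hc.measurable.enorm.pow_const 2), two_mul]
        refine add_le_add (hK _ (le_max_right _ _)) ?_
        rw [lintegral_neg_eq_self
          (fun R : ℝ => ‖F (((max σ 0 : ℝ) : ℂ) + Complex.I * (R : ℂ))‖ₑ ^ 2)]
        exact hK _ (le_max_right _ _)
    _ = 2 * K * ENNReal.ofReal X := by simp

/-- Uses `ab ≤ a² + b²` with `a = ‖F‖` and `b = ‖s - z‖⁻¹`, together with `‖s - z‖ ≥ |R - Im z|` at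
height `R`. -/
theorem enorm_integral_horizontal_le {q : ℂ → ℂ} {z : ℂ}
    (hq : ∀ s, s ≠ z → q s = (s - z)⁻¹ * F s) (X : ℝ) (hX : 0 ≤ X) {R : ℝ} (hR : R ≠ z.im) :
    ‖∫ σ in (0 : ℝ)..X, q ((σ : ℂ) + (R : ℂ) * Complex.I)‖ₑ ≤
      (∫⁻ σ in Set.Ioc 0 X, ‖F ((σ : ℂ) + Complex.I * (R : ℂ))‖ₑ ^ 2) +
      ENNReal.ofReal (((R - z.im) ^ 2)⁻¹) * ENNReal.ofReal X := by
  rw [intervalIntegral.integral_of_le hX]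
  refine (enorm_integral_le_lintegral_enorm _).trans ?_
  have h1 : (∫⁻ σ in Set.Ioc 0 X, ‖F ((σ : ℂ) + Complex.I * (R : ℂ))‖ₑ ^ 2) +
      ENNReal.ofReal (((R - z.im) ^ 2)⁻¹) * ENNReal.ofReal X =
      ∫⁻ σ in Set.Ioc 0 X, (‖F ((σ : ℂ) + Complex.I * (R : ℂ))‖ₑ ^ 2 +
        ENNReal.ofReal (((R - z.im) ^ 2)⁻¹)) := by
    rw [lintegral_add_right _ measurable_const]
    simp
  rw [h1]
  refine lintegral_mono fun σ => ?_
  have hne : (σ : ℂ) + (R : ℂ) * Complex.I ≠ z := fun h => hR (by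
    have := congrArg Complex.im h
    simpa using this)
  rw [hq _ hne, mul_comm (R : ℂ) Complex.I, ← ofReal_norm, ← ofReal_norm,
    ← ENNReal.ofReal_pow (norm_nonneg _),
    ← ENNReal.ofReal_add (by positivity) (by positivity)]
  refine ENNReal.ofReal_le_ofReal ?_
  rw [norm_mul, norm_inv]
  set w := (σ : ℂ) + Complex.I * (R : ℂ) - z with hw
  have hb : (R - z.im) ^ 2 ≤ ‖w‖ ^ 2 := by
    rw [Complex.sq_norm, Complex.normSq_apply, hw]
    simp
    nlinarith [sq_nonneg (σ - z.re)]
  have hpos : 0 < (R - z.im) ^ 2 := by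
    have := sub_ne_zero.2 hR
    positivity
  have h2 : ‖w‖⁻¹ ^ 2 ≤ ((R - z.im) ^ 2)⁻¹ := by
    rw [inv_pow]
    exact inv_anti₀ hpos hb
  nlinarith [sq_nonneg (‖w‖⁻¹ - ‖F ((σ : ℂ) + Complex.I * (R : ℂ))‖),
    inv_nonneg.2 (norm_nonneg w), norm_nonneg (F ((σ : ℂ) + Complex.I * (R : ℂ)))]

theorem integrable_mul_inv_sub_vertical (hδ : 0 < δ)
    (hF : DifferentiableOn ℂ F {s | -δ < s.re}) (hKtop : K ≠ ∞)
    (hK : ∀ x : ℝ, 0 ≤ x → ∫⁻ ω : ℝ, ‖F ((x : ℂ) + Complex.I * (ω : ℂ))‖ₑ ^ 2 ≤ K)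
    {x : ℝ} (hx : 0 ≤ x) {z : ℂ} (hxz : x ≠ z.re) :
    Integrable fun ω : ℝ => F ((x : ℂ) + Complex.I * (ω : ℂ)) *
      (z - x - Complex.I * (ω : ℂ))⁻¹ := by
  refine (memLp_vertical_line hδ hF hKtop hK hx).integrable_mul (memLp_cauchy_kernel ?_)
  simpa [sub_eq_zero] using hxz.symm

/-- Weighted inequality `2ab ≤ ε a² + ε⁻¹ b²`. The `L²` norm of `F` need not become small as the
line moves right; a free `ε` allows `x → ∞` first and `ε → 0` afterwards. -/
theorem norm_integral_vertical_le (hδ : 0 < δ)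
    (hF : DifferentiableOn ℂ F {s | -δ < s.re}) (hKtop : K ≠ ∞)
    (hK : ∀ x : ℝ, 0 ≤ x → ∫⁻ ω : ℝ, ‖F ((x : ℂ) + Complex.I * (ω : ℂ))‖ₑ ^ 2 ≤ K)
    {x : ℝ} (hx : 0 ≤ x) {z : ℂ} (hxz : z.re < x) {ε : ℝ} (hε : 0 < ε) :
    ‖∫ ω : ℝ, F ((x : ℂ) + Complex.I * (ω : ℂ)) * (z - x - Complex.I * (ω : ℂ))⁻¹‖ ≤
      ε * K.toReal + ε⁻¹ * (Real.pi / (x - z.re)) := by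
  have hm := memLp_vertical_line hδ hF hKtop hK hx
  have hre : z.re - x ≠ 0 := by linarith
  have hi := integrable_inv_sq_add_sub_sq hre z.im
  have hi2 := (memLp_two_iff_integrable_sq_norm hm.1).1 hm
  calc ‖∫ ω : ℝ, F ((x : ℂ) + Complex.I * (ω : ℂ)) * (z - x - Complex.I * (ω : ℂ))⁻¹‖
      ≤ ∫ ω : ℝ, (ε * ‖F ((x : ℂ) + Complex.I * (ω : ℂ))‖ ^ 2 +
          ε⁻¹ * ((z.re - x) ^ 2 + (ω - z.im) ^ 2)⁻¹) := by
        refine norm_integral_le_of_norm_le ((hi2.const_mul ε).add (hi.const_mul ε⁻¹))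
          (Eventually.of_forall fun ω => ?_)
        rw [norm_mul, norm_inv]
        have h := sq_norm_sub_I_mul (z - x) ω
        simp only [Complex.sub_re, Complex.ofReal_re, Complex.sub_im, Complex.ofReal_im,
          sub_zero] at h
        rw [← h, ← inv_pow]
        set a := ‖F ((x : ℂ) + Complex.I * (ω : ℂ))‖
        set b := ‖z - x - Complex.I * (ω : ℂ)‖⁻¹
        have h1 : 0 ≤ ε⁻¹ * (ε * a - b) ^ 2 := by positivity
        have h2 : ε⁻¹ * (ε * a - b) ^ 2 = ε * a ^ 2 - 2 * a * b + ε⁻¹ * b ^ 2 := by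
          field_simp
          ring
        have h3 : 0 ≤ a * b := by positivity
        linarith
    _ = ε * (∫ ω : ℝ, ‖F ((x : ℂ) + Complex.I * (ω : ℂ))‖ ^ 2) +
          ε⁻¹ * (Real.pi / (x - z.re)) := by
        rw [integral_add (hi2.const_mul ε) (hi.const_mul ε⁻¹), integral_const_mul,
          integral_const_mul, integral_inv_sq_add_sub_sq hre, abs_of_neg (by linarith), neg_sub]
    _ ≤ _ := by
        gcongr
        exact integral_sq_norm_le_toReal hm hKtop (hK x hx)

/-- Since `F z = 0`, the quotient `F s / (s - z)` has a removable singularity at `z`, so its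
integral around rectangles with sides on `Re s = 0` and `Re s = X` vanishes. The horizontal sides
are negligible along suitable heights. -/
theorem integral_vertical_eq (hδ : 0 < δ)
    (hF : DifferentiableOn ℂ F {s | -δ < s.re}) (hKtop : K ≠ ∞)
    (hK : ∀ x : ℝ, 0 ≤ x → ∫⁻ ω : ℝ, ‖F ((x : ℂ) + Complex.I * (ω : ℂ))‖ₑ ^ 2 ≤ K)
    {z : ℂ} (hz : 0 < z.re) (hFz : F z = 0) {X : ℝ} (hX : z.re < X) :
    ∫ ω : ℝ, F (Complex.I * (ω : ℂ)) * (z - Complex.I * (ω : ℂ))⁻¹ =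
      ∫ ω : ℝ, F ((X : ℂ) + Complex.I * (ω : ℂ)) * (z - X - Complex.I * (ω : ℂ))⁻¹ := by
  have hX0 : 0 ≤ X := (hz.trans hX).le
  have hopen : IsOpen {s : ℂ | -δ < s.re} := isOpen_lt continuous_const Complex.continuous_re
  have hzmem : {s : ℂ | -δ < s.re} ∈ 𝓝 z := hopen.mem_nhds (by simp; linarith)
  set q := dslope F z with hqdef
  have hqd : DifferentiableOn ℂ q {s | -δ < s.re} :=
    (Complex.differentiableOn_dslope hzmem).2 hF
  have hq : ∀ s, s ≠ z → q s = (s - z)⁻¹ * F s := by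
    intro s hs
    rw [hqdef, dslope_of_ne _ hs, slope_def_module, hFz, sub_zero, smul_eq_mul]
  have hq' : ∀ x : ℝ, x ≠ z.re → ∀ ω : ℝ, q ((x : ℂ) + (ω : ℂ) * Complex.I) =
      -(F ((x : ℂ) + Complex.I * (ω : ℂ)) * (z - x - Complex.I * (ω : ℂ))⁻¹) := by
    intro x hx ω
    rw [hq, mul_comm (ω : ℂ), ← mul_neg, mul_comm, ← inv_neg]
    · congr 2
      ring
    · intro h
      apply hx
      have := congrArg Complex.re h
      simpa using this
  have hint : ∀ x : ℝ, 0 ≤ x → x ≠ z.re →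
      Integrable fun ω : ℝ => q ((x : ℂ) + (ω : ℂ) * Complex.I) := by
    intro x hx hxz
    simp only [hq' x hxz]
    exact (integrable_mul_inv_sub_vertical hδ hF hKtop hK hx hxz).neg
  have hlim : ∀ x : ℝ, 0 ≤ x → x ≠ z.re →
      Tendsto (fun R : ℝ => ∫ ω in (-R)..R, q ((x : ℂ) + (ω : ℂ) * Complex.I)) atTop
        (𝓝 (∫ ω : ℝ, q ((x : ℂ) + (ω : ℂ) * Complex.I))) := fun x hx hxz =>
    intervalIntegral_tendsto_integral (hint x hx hxz) tendsto_neg_atTop_atBot tendsto_id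
  have hrect : ∀ R : ℝ, (∫ ω in (-R)..R, q ((X : ℂ) + (ω : ℂ) * Complex.I)) -
      (∫ ω in (-R)..R, q (((0 : ℝ) : ℂ) + (ω : ℂ) * Complex.I)) =
      Complex.I * ((∫ σ in (0 : ℝ)..X, q ((σ : ℂ) + ((-R : ℝ) : ℂ) * Complex.I)) -
        ∫ σ in (0 : ℝ)..X, q ((σ : ℂ) + (R : ℂ) * Complex.I)) := by
    intro R
    have h := Complex.integral_boundary_rect_eq_zero_of_differentiableOn q ⟨0, -R⟩ ⟨X, R⟩
      (hqd.mono ?_)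
    · simp only [smul_eq_mul] at h
      linear_combination (-Complex.I) * h + ((∫ ω in (-R)..R, q ((X : ℂ) + (ω : ℂ) * Complex.I)) -
      (∫ ω in (-R)..R, q (((0 : ℝ) : ℂ) + (ω : ℂ) * Complex.I))) * Complex.I_sq
    · intro s hs
      have h1 := (Complex.mem_reProdIm.1 hs).1
      rw [Set.uIcc_of_le hX0] at h1
      have := h1.1
      simp only [Set.mem_ofPred_eq] at this ⊢
      linarith
  have hzero : (∫ ω : ℝ, q ((X : ℂ) + (ω : ℂ) * Complex.I)) -
      (∫ ω : ℝ, q (((0 : ℝ) : ℂ) + (ω : ℂ) * Complex.I)) = 0 := by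
    rw [← enorm_eq_zero, ← le_zero_iff]
    refine le_of_forall_pos_le_add fun ε hε => ?_
    rw [zero_add]
    have hD := ((hlim X hX0 hX.ne').sub (hlim 0 le_rfl hz.ne)).enorm
    have hkern : Tendsto (fun R : ℝ => ENNReal.ofReal (((-R - z.im) ^ 2)⁻¹) * ENNReal.ofReal X +
        ENNReal.ofReal (((R - z.im) ^ 2)⁻¹) * ENNReal.ofReal X) atTop (𝓝 0) := by
      have h1 : Tendsto (fun R : ℝ => ((R - z.im) ^ 2)⁻¹) atTop (𝓝 0) :=
        tendsto_inv_atTop_zero.comp ((tendsto_pow_atTop two_ne_zero).comp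
          (tendsto_atTop_add_const_right _ _ tendsto_id))
      have h2 : Tendsto (fun R : ℝ => ((-R - z.im) ^ 2)⁻¹) atTop (𝓝 0) := by
        have : Tendsto (fun R : ℝ => ((R + z.im) ^ 2)⁻¹) atTop (𝓝 0) :=
          tendsto_inv_atTop_zero.comp ((tendsto_pow_atTop two_ne_zero).comp
            (tendsto_atTop_add_const_right _ _ tendsto_id))
        refine this.congr fun R => ?_
        congr 1
        ring
      have h3 : ∀ {u : ℝ → ℝ}, Tendsto u atTop (𝓝 0) →
          Tendsto (fun R => ENNReal.ofReal (u R) * ENNReal.ofReal X) atTop (𝓝 0) := by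
        intro u hu
        have := ENNReal.Tendsto.mul_const (b := ENNReal.ofReal X) (ENNReal.tendsto_ofReal hu)
          (Or.inr ENNReal.ofReal_ne_top)
        simpa using this
      simpa using (h3 h2).add (h3 h1)
    have hsum : ∀ R : ℝ, R ≠ z.im → -R ≠ z.im →
        ‖(∫ ω in (-R)..R, q ((X : ℂ) + (ω : ℂ) * Complex.I)) -
          (∫ ω in (-R)..R, q (((0 : ℝ) : ℂ) + (ω : ℂ) * Complex.I))‖ₑ ≤
        (∫⁻ σ in Set.Ioc 0 X, (‖F ((σ : ℂ) + Complex.I * (R : ℂ))‖ₑ ^ 2 +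
          ‖F ((σ : ℂ) + Complex.I * ((-R : ℝ) : ℂ))‖ₑ ^ 2)) +
        (ENNReal.ofReal (((-R - z.im) ^ 2)⁻¹) * ENNReal.ofReal X +
          ENNReal.ofReal (((R - z.im) ^ 2)⁻¹) * ENNReal.ofReal X) := by
      intro R h1 h2
      rw [hrect, enorm_mul]
      have hI : ‖Complex.I‖ₑ = 1 := by rw [← ofReal_norm]; simp
      rw [hI, one_mul]
      refine (enorm_sub_le).trans ((add_le_add (enorm_integral_horizontal_le hq X hX0 h2)
        (enorm_integral_horizontal_le hq X hX0 h1)).trans (le_of_eq ?_))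
      rw [lintegral_add_left']
      · ring
      · refine AEMeasurable.pow_const (AEMeasurable.enorm ?_) 2
        refine ContinuousOn.aemeasurable ?_ measurableSet_Ioc
        refine hF.continuousOn.comp (by fun_prop) fun σ hσ => ?_
        simp
        linarith [hσ.1]
    -- The difference of the vertical integrals already has a limit as `R → ∞`, so smallness at
    -- arbitrarily large `R` is enough.
    refine le_of_tendsto_of_frequently hD ?_
    have hfreq := frequently_lintegral_horizontal_lt hδ hF hKtop hK X
      (ENNReal.half_pos hε.ne').ne'
    have hev := hkern.eventually (gt_mem_nhds (ENNReal.half_pos hε.ne'))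
    refine (hfreq.and_eventually (hev.and ((eventually_gt_atTop z.im).and
      (eventually_gt_atTop (-z.im))))).mono fun R hR => ?_
    obtain ⟨h1, h2, h3, h4⟩ := hR
    refine (hsum R h3.ne' (by linarith)).trans ((add_le_add h1.le h2.le).trans ?_)
    rw [ENNReal.add_halves]
  have h0 := sub_eq_zero.1 hzero
  simp only [hq' X hX.ne', hq' 0 hz.ne, integral_neg, neg_inj] at h0
  rw [h0]
  simp

/-- The Cauchy integral over the imaginary axis vanishes at a zero of the function. -/
theorem integral_cauchy_eq_zero (hδ : 0 < δ)
    (hF : DifferentiableOn ℂ F {s | -δ < s.re}) (hKtop : K ≠ ∞)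
    (hK : ∀ x : ℝ, 0 ≤ x → ∫⁻ ω : ℝ, ‖F ((x : ℂ) + Complex.I * (ω : ℂ))‖ₑ ^ 2 ≤ K)
    {z : ℂ} (hz : 0 < z.re) (hFz : F z = 0) :
    ∫ ω : ℝ, F (Complex.I * (ω : ℂ)) * (z - Complex.I * (ω : ℂ))⁻¹ = 0 := by
  set J := ∫ ω : ℝ, F (Complex.I * (ω : ℂ)) * (z - Complex.I * (ω : ℂ))⁻¹ with hJ
  have h1 : ∀ ε : ℝ, 0 < ε → ‖J‖ ≤ ε * K.toReal := by
    intro ε hε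
    have hlim : Tendsto (fun X : ℝ => ε * K.toReal + ε⁻¹ * (Real.pi / (X - z.re))) atTop
        (𝓝 (ε * K.toReal + ε⁻¹ * 0)) :=
      ((Tendsto.const_div_atTop (tendsto_atTop_add_const_right _ _ tendsto_id) _).const_mul
        _).const_add _
    rw [mul_zero, add_zero] at hlim
    refine ge_of_tendsto hlim ?_
    filter_upwards [eventually_gt_atTop z.re] with X hX
    rw [hJ, integral_vertical_eq hδ hF hKtop hK hz hFz hX]
    exact norm_integral_vertical_le hδ hF hKtop hK (hz.trans hX).le hX hε
  have hlim : Tendsto (fun ε : ℝ => ε * K.toReal) (𝓝[>] 0) (𝓝 (0 * K.toReal)) :=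
    (tendsto_id.mul_const _).mono_left nhdsWithin_le_nhds
  rw [zero_mul] at hlim
  have := ge_of_tendsto hlim (eventually_nhdsWithin_of_forall fun ε hε => h1 ε hε)
  exact norm_le_zero_iff.1 this

end Strip

/-! ### Cauchy's formula in the scalar Hardy space. -/

theorem enorm_sub_sq_le (a b : ℂ) : ‖a - b‖ₑ ^ 2 ≤ 2 * ‖a‖ₑ ^ 2 + 2 * ‖b‖ₑ ^ 2 := by
  simp only [← ofReal_norm, ← ENNReal.ofReal_pow (norm_nonneg _)]
  have h2 : (2 : ℝ≥0∞) = ENNReal.ofReal 2 := by simp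
  rw [h2, ← ENNReal.ofReal_mul two_pos.le, ← ENNReal.ofReal_mul two_pos.le,
    ← ENNReal.ofReal_add (by positivity) (by positivity)]
  refine ENNReal.ofReal_le_ofReal ?_
  nlinarith [norm_sub_le a b, sq_nonneg (‖a‖ - ‖b‖), norm_nonneg (a - b)]

/-- The two factors are complex conjugates of each other, so the product is `‖z - iω‖²`. -/
theorem add_conj_mul_sub (z : ℂ) (ω : ℝ) :
    (Complex.I * (ω : ℂ) + conj z) * (z - Complex.I * (ω : ℂ)) =
      ((z.re ^ 2 + (ω - z.im) ^ 2 : ℝ) : ℂ) := by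
  apply Complex.ext
  · rw [Complex.ofReal_re]
    simp
    ring
  · rw [Complex.ofReal_im]
    simp
    ring

theorem integral_reproducing_kernel {z : ℂ} (hz : 0 < z.re) :
    ∫ ω : ℝ, (z + conj z) * (Complex.I * (ω : ℂ) + conj z)⁻¹ * (z - Complex.I * (ω : ℂ))⁻¹ =
      2 * Real.pi := by
  simp_rw [mul_assoc, ← mul_inv, add_conj_mul_sub, ← Complex.ofReal_inv]
  rw [integral_const_mul, integral_complex_ofReal, integral_inv_sq_add_sub_sq hz.ne',
    Complex.add_conj, abs_of_pos hz]
  have : (z.re : ℂ) ≠ 0 := by exact_mod_cast hz.ne'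
  push_cast
  field_simp

theorem lintegral_sq_inv_add_conj_le {z : ℂ} (hz : 0 < z.re) {x : ℝ} (hx : 0 ≤ x) :
    ∫⁻ ω : ℝ, ‖((x : ℂ) + Complex.I * (ω : ℂ) + conj z)⁻¹‖ₑ ^ 2 ≤
      ENNReal.ofReal (Real.pi / z.re) := by
  have h := integral_inv_sq_add_sub_sq hz.ne' z.im
  rw [abs_of_pos hz] at h
  rw [← h, ofReal_integral_eq_lintegral_ofReal (integrable_inv_sq_add_sub_sq hz.ne' _)
    (Eventually.of_forall fun ω => by positivity)]
  refine lintegral_mono fun ω => ?_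
  rw [← ofReal_norm, ← ENNReal.ofReal_pow (norm_nonneg _), norm_inv, inv_pow]
  refine ENNReal.ofReal_le_ofReal (inv_anti₀ (by positivity) ?_)
  rw [Complex.sq_norm, Complex.normSq_apply]
  simp
  nlinarith

/-- The scalar Hardy space `H₂` of the right half-plane. -/
structure MemScalarH2 (h : ℂ → ℂ) : Prop where
  differentiableOn : DifferentiableOn ℂ h {s : ℂ | 0 < s.re}
  bounded : ∃ K : ℝ≥0∞, K ≠ ∞ ∧ ∀ x : ℝ, 0 < x →
    ∫⁻ ω : ℝ, ‖h ((x : ℂ) + Complex.I * (ω : ℂ))‖ₑ ^ 2 ≤ K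
  boundary : ∀ᵐ ω : ℝ, Tendsto (fun x : ℝ => h ((x : ℂ) + Complex.I * (ω : ℂ))) (𝓝[>] 0)
    (𝓝 (h (Complex.I * (ω : ℂ))))

namespace MemScalarH2

variable {h : ℂ → ℂ}

theorem continuous_line (hh : MemScalarH2 h) {x : ℝ} (hx : 0 < x) :
    Continuous fun ω : ℝ => h ((x : ℂ) + Complex.I * (ω : ℂ)) := by
  refine hh.differentiableOn.continuousOn.comp_continuous (by fun_prop) fun ω => ?_
  simpa using hx

/-- Fatou's lemma and weak convergence are available for sequences, so the lines `Re s = 1 / (n +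
1)` replace `x → 0⁺`. -/
theorem boundary_seq (hh : MemScalarH2 h) : ∀ᵐ ω : ℝ,
    Tendsto (fun n : ℕ => h (((1 / ((n : ℝ) + 1) : ℝ) : ℂ) + Complex.I * (ω : ℂ))) atTop
      (𝓝 (h (Complex.I * (ω : ℂ)))) := by
  have hseq : Tendsto (fun n : ℕ => 1 / ((n : ℝ) + 1)) atTop (𝓝[>] 0) :=
    tendsto_nhdsWithin_iff.2 ⟨tendsto_one_div_add_atTop_nhds_zero_nat,
      Eventually.of_forall fun n => by simp only [Set.mem_Ioi]; positivity⟩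
  filter_upwards [hh.boundary] with ω hω
  exact hω.comp hseq

theorem memLp_boundary (hh : MemScalarH2 h) :
    MemLp (fun ω : ℝ => h (Complex.I * (ω : ℂ))) 2 volume := by
  obtain ⟨K, hKtop, hK⟩ := hh.bounded
  have hm : ∀ n : ℕ, AEStronglyMeasurable (fun ω : ℝ =>
      h (((1 / ((n : ℝ) + 1) : ℝ) : ℂ) + Complex.I * (ω : ℂ))) volume := fun n =>
    (hh.continuous_line (by positivity)).aestronglyMeasurable
  refine memLp_two_of_lintegral_sq_ne_top
    (aestronglyMeasurable_of_tendsto_ae atTop hm hh.boundary_seq)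
    (ne_top_of_le_ne_top hKtop (lintegral_sq_le_of_ae_tendsto hm (fun n => ?_) hh.boundary_seq))
  exact hK _ (by positivity)

/-- The Cauchy integral formula on a vertical line in the open right half-plane. -/
theorem integral_cauchy_line (hh : MemScalarH2 h) {x : ℝ} (hx : 0 < x) {z : ℂ} (hz : 0 < z.re) :
    ∫ ω : ℝ, h ((x : ℂ) + Complex.I * (ω : ℂ)) * (z - Complex.I * (ω : ℂ))⁻¹ =
      2 * Real.pi * h (x + z) := by
  obtain ⟨K, hKtop, hK⟩ := hh.bounded
  -- Chosen so that `F` below vanishes at `z`. The subtracted term has its only pole at `-conj z`,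
  -- in the left half-plane, and its Cauchy integral is known explicitly from
  -- `integral_reproducing_kernel`.
  set c : ℂ := h (x + z) * (z + conj z) with hc
  let F : ℂ → ℂ := fun s => h (x + s) - c * (s + conj z)⁻¹
  have hzz : z + conj z ≠ 0 := by
    rw [Complex.add_conj]
    exact_mod_cast (by positivity : (2 * z.re) ≠ 0)
  -- The shift by `x` makes the first term analytic for `Re s > -x`; the second is analytic for `Re
  -- s > -Re z`.
  have hF : DifferentiableOn ℂ F {s | -(min x z.re) < s.re} := by
    refine DifferentiableOn.sub ?_ (DifferentiableOn.const_mul (DifferentiableOn.inv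
      (by fun_prop) fun s hs => ?_) _)
    · refine hh.differentiableOn.comp (by fun_prop) fun s hs => ?_
      have := min_le_left x z.re
      simp only [Set.mem_ofPred_eq, Complex.add_re, Complex.ofReal_re] at hs ⊢
      linarith
    · intro h0
      have h1 := congrArg Complex.re h0
      have := min_le_right x z.re
      simp only [Set.mem_ofPred_eq, Complex.add_re, Complex.conj_re, Complex.zero_re] at hs h1
      linarith
  have hFz : F z = 0 := by
    simp only [F, hc]
    field_simp
    simp
  have hFK : ∀ y : ℝ, 0 ≤ y → ∫⁻ ω : ℝ, ‖F ((y : ℂ) + Complex.I * (ω : ℂ))‖ₑ ^ 2 ≤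
      2 * K + 2 * (‖c‖ₑ ^ 2 * ENNReal.ofReal (Real.pi / z.re)) := by
    intro y hy
    have hcont : Continuous fun ω : ℝ => h ((x : ℂ) + ((y : ℂ) + Complex.I * (ω : ℂ))) := by
      have := hh.continuous_line (add_pos_of_pos_of_nonneg hx hy)
      simpa only [Complex.ofReal_add, add_assoc] using this
    calc ∫⁻ ω : ℝ, ‖F ((y : ℂ) + Complex.I * (ω : ℂ))‖ₑ ^ 2
        ≤ ∫⁻ ω : ℝ, (2 * ‖h ((x : ℂ) + ((y : ℂ) + Complex.I * (ω : ℂ)))‖ₑ ^ 2 +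
          2 * (‖c‖ₑ ^ 2 * ‖((y : ℂ) + Complex.I * (ω : ℂ) + conj z)⁻¹‖ₑ ^ 2)) := by
          refine lintegral_mono fun ω => ?_
          rw [← mul_pow, ← enorm_mul]
          exact enorm_sub_sq_le _ _
      _ = 2 * (∫⁻ ω : ℝ, ‖h ((x : ℂ) + ((y : ℂ) + Complex.I * (ω : ℂ)))‖ₑ ^ 2) +
          2 * (‖c‖ₑ ^ 2 * ∫⁻ ω : ℝ, ‖((y : ℂ) + Complex.I * (ω : ℂ) + conj z)⁻¹‖ₑ ^ 2) := by
          rw [lintegral_add_left ((hcont.measurable.enorm.pow_const 2).const_mul 2),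
            lintegral_const_mul' _ _ (by simp), lintegral_const_mul' _ _ (by simp),
            lintegral_const_mul' _ _ (by simp)]
      _ ≤ _ := by
          gcongr
          · have := hK (x + y) (add_pos_of_pos_of_nonneg hx hy)
            simpa only [Complex.ofReal_add, add_assoc] using this
          · exact lintegral_sq_inv_add_conj_le hz hy
  have h0 := integral_cauchy_eq_zero (lt_min hx hz) hF (by finiteness) hFK hz hFz
  have hi1 : Integrable fun ω : ℝ =>
      h ((x : ℂ) + Complex.I * (ω : ℂ)) * (z - Complex.I * (ω : ℂ))⁻¹ :=
    (memLp_two_of_lintegral_sq_ne_top (hh.continuous_line hx).aestronglyMeasurable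
      (ne_top_of_le_ne_top hKtop (hK x hx))).integrable_mul (memLp_cauchy_kernel hz.ne')
  have hi2 : Integrable fun ω : ℝ =>
      h (x + z) * ((z + conj z) * (Complex.I * (ω : ℂ) + conj z)⁻¹ *
        (z - Complex.I * (ω : ℂ))⁻¹) := by
    simp_rw [mul_assoc, ← mul_inv, add_conj_mul_sub, ← Complex.ofReal_inv]
    exact ((integrable_inv_sq_add_sub_sq hz.ne' _).ofReal.const_mul _).const_mul _
  have hsplit : ∀ ω : ℝ, F (Complex.I * (ω : ℂ)) * (z - Complex.I * (ω : ℂ))⁻¹ =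
      h ((x : ℂ) + Complex.I * (ω : ℂ)) * (z - Complex.I * (ω : ℂ))⁻¹ -
        h (x + z) * ((z + conj z) * (Complex.I * (ω : ℂ) + conj z)⁻¹ *
          (z - Complex.I * (ω : ℂ))⁻¹) := fun ω => by
    simp only [F, hc]
    ring
  simp only [hsplit] at h0
  rw [integral_sub hi1 hi2, integral_const_mul, integral_reproducing_kernel hz] at h0
  linear_combination h0

/-- The Cauchy integral formula over the imaginary axis. -/
theorem integral_cauchy (hh : MemScalarH2 h) {z : ℂ} (hz : 0 < z.re) :
    ∫ ω : ℝ, h (Complex.I * (ω : ℂ)) * (z - Complex.I * (ω : ℂ))⁻¹ = 2 * Real.pi * h z := by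
  obtain ⟨K, hKtop, hK⟩ := hh.bounded
  have hpos : ∀ n : ℕ, 0 < 1 / ((n : ℝ) + 1) := fun n => by positivity
  have h1 := tendsto_integral_mul_of_ae_tendsto
    (fun n : ℕ => (hh.continuous_line (hpos n)).aestronglyMeasurable) hKtop
    (fun n => hK _ (hpos n)) hh.boundary_seq (memLp_cauchy_kernel hz.ne')
  simp only [hh.integral_cauchy_line (hpos _) hz] at h1
  have hopen : IsOpen {s : ℂ | 0 < s.re} := isOpen_lt continuous_const Complex.continuous_re
  have hcz : ContinuousAt h z :=
    (hh.differentiableOn.differentiableAt (hopen.mem_nhds hz)).continuousAt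
  have hseq : Tendsto (fun n : ℕ => ((1 / ((n : ℝ) + 1) : ℝ) : ℂ) + z) atTop (𝓝 z) := by
    have := ((Complex.continuous_ofReal.tendsto 0).comp
      tendsto_one_div_add_atTop_nhds_zero_nat).add_const z
    simpa using this
  exact tendsto_nhds_unique h1 ((hcz.tendsto.comp hseq).const_mul _)

/-- The Cauchy integral formula for the derivative, over the imaginary axis. -/
theorem integral_cauchy_deriv (hh : MemScalarH2 h) {z : ℂ} (hz : 0 < z.re) :
    ∫ ω : ℝ, h (Complex.I * (ω : ℂ)) * ((z - Complex.I * (ω : ℂ)) ^ 2)⁻¹ =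
      -(2 * Real.pi * deriv h z) := by
  have hopen : IsOpen {s : ℂ | 0 < s.re} := isOpen_lt continuous_const Complex.continuous_re
  have hm := hh.memLp_boundary
  have hr : 0 < z.re / 2 := by positivity
  have hball : ∀ w ∈ Metric.ball z (z.re / 2), z.re / 2 < w.re := by
    intro w hw
    have h1 := (Complex.abs_re_le_norm (w - z)).trans_lt (by simpa [dist_eq_norm] using hw)
    rw [Complex.sub_re, abs_lt] at h1
    linarith [h1.1]
  -- With `‖w - iω‖ ≥ Re z / 2` this gives `‖w - iω‖⁻² ≤ (4 / Re z) ‖z - iω‖⁻¹`, a bound uniform in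
  -- `w` that permits differentiation under the integral.
  have hcmp : ∀ w ∈ Metric.ball z (z.re / 2), ∀ ω : ℝ,
      ‖z - Complex.I * (ω : ℂ)‖ ≤ 2 * ‖w - Complex.I * (ω : ℂ)‖ := by
    intro w hw ω
    have h1 : z.re / 2 ≤ ‖w - Complex.I * (ω : ℂ)‖ := by
      refine le_trans (hball w hw).le ?_
      have := Complex.re_le_norm (w - Complex.I * (ω : ℂ))
      simpa using this
    have h2 : ‖z - w‖ < z.re / 2 := by rw [norm_sub_rev]; simpa [dist_eq_norm] using hw
    have h3 : z - Complex.I * (ω : ℂ) = (z - w) + (w - Complex.I * (ω : ℂ)) := by ring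
    rw [h3]
    linarith [norm_add_le (z - w) (w - Complex.I * (ω : ℂ))]
  have key := hasDerivAt_integral_of_dominated_loc_of_deriv_le (μ := volume) (x₀ := z)
    (s := Metric.ball z (z.re / 2))
    (F := fun w ω => h (Complex.I * (ω : ℂ)) * (w - Complex.I * (ω : ℂ))⁻¹)
    (F' := fun w ω => h (Complex.I * (ω : ℂ)) * -((w - Complex.I * (ω : ℂ)) ^ 2)⁻¹)
    (bound := fun ω : ℝ => 4 / (z.re) * (‖h (Complex.I * (ω : ℂ))‖ *
      ‖(z - Complex.I * (ω : ℂ))⁻¹‖))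
    (Metric.ball_mem_nhds z hr) ?_ ?_ ?_ ?_ ?_ ?_
  · have h1 : (fun w => ∫ ω : ℝ, h (Complex.I * (ω : ℂ)) * (w - Complex.I * (ω : ℂ))⁻¹) =ᶠ[𝓝 z]
        fun w => 2 * Real.pi * h w := by
      filter_upwards [hopen.mem_nhds hz] with w hw
      exact hh.integral_cauchy hw
    have h2 := (h1.hasDerivAt_iff.1 key.2).unique
      ((hh.differentiableOn.differentiableAt (hopen.mem_nhds hz)).hasDerivAt.const_mul _)
    simp only [mul_neg, integral_neg] at h2
    rw [← h2, neg_neg]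
  · filter_upwards [hopen.mem_nhds hz] with w hw
    exact hm.1.mul (continuous_cauchy_kernel (ne_of_gt hw)).aestronglyMeasurable
  · exact hm.integrable_mul (memLp_cauchy_kernel hz.ne')
  · refine hm.1.mul (Continuous.aestronglyMeasurable ?_)
    exact (Continuous.inv₀ (by fun_prop) fun ω =>
      pow_ne_zero 2 (sub_I_mul_ne_zero hz.ne' ω)).neg
  · refine Eventually.of_forall fun ω w hw => ?_
    rw [norm_mul, norm_neg, norm_inv, norm_inv, norm_pow, mul_left_comm]
    refine mul_le_mul_of_nonneg_left ?_ (norm_nonneg _)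
    have h1 := hcmp w hw ω
    have h2 : z.re / 2 ≤ ‖w - Complex.I * (ω : ℂ)‖ := by
      refine le_trans (hball w hw).le ?_
      have := Complex.re_le_norm (w - Complex.I * (ω : ℂ))
      simpa using this
    have h3 : 0 < ‖z - Complex.I * (ω : ℂ)‖ := norm_pos_iff.2 (sub_I_mul_ne_zero hz.ne' ω)
    have h4 : 0 < ‖w - Complex.I * (ω : ℂ)‖ := hr.trans_le h2
    rw [← div_eq_mul_inv, div_div, ← one_div, div_le_div_iff₀ (by positivity) (by positivity)]
    nlinarith
  · exact (hm.norm.integrable_mul (memLp_cauchy_kernel hz.ne').norm).const_mul _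
  · refine Eventually.of_forall fun ω w hw => ?_
    have hne : w - Complex.I * (ω : ℂ) ≠ 0 :=
      sub_I_mul_ne_zero (hr.trans (hball w hw)).ne' ω
    have h1 : HasDerivAt (fun w : ℂ => (w - Complex.I * (ω : ℂ))⁻¹)
        (-((w - Complex.I * (ω : ℂ)) ^ 2)⁻¹) w := by
      have := ((hasDerivAt_id w).sub_const (Complex.I * (ω : ℂ))).fun_inv hne
      simpa [neg_div] using this
    exact h1.const_mul _

end MemScalarH2

/-! ### Matrix-valued Hardy functions and reality on the axis. -/

section HardySpace

variable {m p : ℕ} {G H : ℂ → Matrix (Fin p) (Fin m) ℂ}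

theorem enorm_sq_le_frobeniusSq (M : Matrix (Fin p) (Fin m) ℂ) (i : Fin p) (j : Fin m) :
    ‖M i j‖ₑ ^ 2 ≤ frobeniusSq M :=
  (Finset.single_le_sum (f := fun j => ‖M i j‖ₑ ^ 2) (fun _ _ => zero_le)
    (Finset.mem_univ j)).trans
    (Finset.single_le_sum (f := fun i => ∑ j, ‖M i j‖ₑ ^ 2) (fun _ _ => zero_le)
      (Finset.mem_univ i))

theorem MemH2.entry (hH : MemH2 H) (i : Fin p) (j : Fin m) : MemScalarH2 fun s => H s i j := by
  obtain ⟨K, hKtop, hK⟩ := hH.bounded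
  exact ⟨hH.differentiableOn i j, ⟨K, hKtop, fun x hx =>
    (lintegral_mono fun ω => enorm_sq_le_frobeniusSq _ i j).trans (hK x hx)⟩, hH.boundary i j⟩

theorem frobeniusSq_sub_le (M N : Matrix (Fin p) (Fin m) ℂ) :
    frobeniusSq (M - N) ≤ 2 * frobeniusSq M + 2 * frobeniusSq N := by
  simp only [frobeniusSq, Finset.mul_sum, ← Finset.sum_add_distrib]
  exact Finset.sum_le_sum fun i _ => Finset.sum_le_sum fun j _ => enorm_sub_sq_le _ _

theorem MemH2.sub (hH : MemH2 H) (hG : MemH2 G) : MemH2 fun s => H s - G s := by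
  obtain ⟨K, hKtop, hK⟩ := hH.bounded
  obtain ⟨L, hLtop, hL⟩ := hG.bounded
  refine ⟨fun i j => (hH.differentiableOn i j).sub (hG.differentiableOn i j),
    ⟨2 * K + 2 * L, by finiteness, fun x hx => ?_⟩, fun i j => ?_⟩
  · have hm : Measurable fun ω : ℝ => frobeniusSq (H ((x : ℂ) + Complex.I * (ω : ℂ))) := by
      unfold frobeniusSq
      exact Finset.measurable_sum _ fun i _ => Finset.measurable_sum _ fun j _ =>
        ((hH.entry i j).continuous_line hx).measurable.enorm.pow_const 2
    calc _ ≤ ∫⁻ ω : ℝ, (2 * frobeniusSq (H ((x : ℂ) + Complex.I * (ω : ℂ))) +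
          2 * frobeniusSq (G ((x : ℂ) + Complex.I * (ω : ℂ)))) :=
          lintegral_mono fun ω => frobeniusSq_sub_le _ _
      _ = 2 * (∫⁻ ω : ℝ, frobeniusSq (H ((x : ℂ) + Complex.I * (ω : ℂ)))) +
          2 * ∫⁻ ω : ℝ, frobeniusSq (G ((x : ℂ) + Complex.I * (ω : ℂ))) := by
          rw [lintegral_add_left (hm.const_mul 2), lintegral_const_mul' _ _ (by simp),
            lintegral_const_mul' _ _ (by simp)]
      _ ≤ _ := by
          gcongr
          · exact hK x hx
          · exact hL x hx
  · filter_upwards [hH.boundary i j, hG.boundary i j] with ω h1 h2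
    exact h1.sub h2

theorem IsRealTransfer.sub (hH : IsRealTransfer H) (hG : IsRealTransfer G) :
    IsRealTransfer fun s => H s - G s := by
  intro s hs
  simp only
  rw [hH s hs, hG s hs]
  ext i j
  simp

theorem ae_comp_neg {P : ℝ → Prop} (h : ∀ᵐ ω : ℝ, P ω) : ∀ᵐ ω : ℝ, P (-ω) :=
  (Measure.measurePreserving_neg (volume : Measure ℝ)).quasiMeasurePreserving.ae h

/-- The symmetry is assumed only in the open half-plane; it passes to the limit `x → 0⁺` wherever
boundary limits exist at both `ω` and `-ω`. -/
theorem IsRealTransfer.ae_axis (hreal : IsRealTransfer H) (hH : MemH2 H) (i : Fin p) (j : Fin m) :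
    ∀ᵐ ω : ℝ, H (Complex.I * ((-ω : ℝ) : ℂ)) i j = conj (H (Complex.I * (ω : ℂ)) i j) := by
  filter_upwards [hH.boundary i j, ae_comp_neg (hH.boundary i j)] with ω h1 h2
  refine tendsto_nhds_unique h2 (((Complex.continuous_conj.tendsto _).comp h1).congr' ?_)
  filter_upwards [self_mem_nhdsWithin] with x hx
  have hs : 0 < ((x : ℂ) + Complex.I * (ω : ℂ)).re := by simpa using hx
  have h3 := congrFun (congrFun (hreal _ hs) i) j
  have h4 : conj ((x : ℂ) + Complex.I * (ω : ℂ)) = (x : ℂ) + Complex.I * ((-ω : ℝ) : ℂ) := by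
    simp
  rw [h4] at h3
  simpa using h3.symm

end HardySpace

/-! ### First-order condition for a least-squares minimum. -/

theorem norm_sub_add_sq_le {f g R : ℂ} {t b : ℝ} (ht : |t| ≤ 1) (hR : ‖R‖ ^ 2 ≤ b) :
    ‖f - (t * g + t ^ 2 * R)‖ ^ 2 ≤ ‖f‖ ^ 2 - 2 * t * (conj f * g).re +
      t ^ 2 * (2 * ‖f‖ ^ 2 + 3 * ‖g‖ ^ 2 + 2 * b) := by
  have ht2 : t ^ 2 ≤ 1 := (sq_le_one_iff_abs_le_one t).2 ht
  have h1 : ‖f - (t * g + t ^ 2 * R)‖ ≤ ‖f - t * g‖ + t ^ 2 * ‖R‖ := by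
    have h2 : f - (t * g + t ^ 2 * R) = (f - t * g) - ((t ^ 2 : ℝ) : ℂ) * R := by
      push_cast
      ring
    rw [h2]
    refine (norm_sub_le _ _).trans (le_of_eq ?_)
    rw [norm_mul, Complex.norm_real, Real.norm_of_nonneg (sq_nonneg t)]
  have h2 : ‖f - t * g‖ ^ 2 = ‖f‖ ^ 2 - 2 * t * (conj f * g).re + t ^ 2 * ‖g‖ ^ 2 := by
    simp only [Complex.sq_norm, Complex.normSq_apply, Complex.sub_re, Complex.sub_im,
      Complex.mul_re, Complex.mul_im, Complex.ofReal_re, Complex.ofReal_im, Complex.conj_re,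
      Complex.conj_im]
    ring
  have h3 : ‖f - t * g‖ ^ 2 ≤ 2 * ‖f‖ ^ 2 + 2 * ‖g‖ ^ 2 := by
    have h4 := norm_sub_le f (t * g)
    rw [norm_mul, Complex.norm_real, Real.norm_eq_abs] at h4
    have h5 : |t| * ‖g‖ ≤ ‖g‖ := mul_le_of_le_one_left (norm_nonneg _) ht
    have h6 : ‖f - t * g‖ ≤ ‖f‖ + ‖g‖ := by linarith
    nlinarith [sq_nonneg (‖f‖ - ‖g‖), norm_nonneg (f - t * g)]
  have h7 : ‖f - (t * g + t ^ 2 * R)‖ ^ 2 ≤ (‖f - t * g‖ + t ^ 2 * ‖R‖) ^ 2 :=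
    pow_le_pow_left₀ (norm_nonneg _) h1 2
  have h8 : 0 ≤ t ^ 2 * (‖f - t * g‖ - ‖R‖) ^ 2 := by positivity
  have h9 : t ^ 2 * (t ^ 2 * ‖R‖ ^ 2) ≤ t ^ 2 * (1 * ‖R‖ ^ 2) := by gcongr
  have h10 : t ^ 2 * ‖f - t * g‖ ^ 2 ≤ t ^ 2 * (2 * ‖f‖ ^ 2 + 2 * ‖g‖ ^ 2) := by gcongr
  have h11 : t ^ 2 * ‖R‖ ^ 2 ≤ t ^ 2 * b := by gcongr
  nlinarith

/-- Divide by `t` and let `t → 0` from each side. -/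
theorem eq_zero_of_forall_mul_le_sq_mul {ρ C t₀ : ℝ} (ht₀ : 0 < t₀)
    (h : ∀ t : ℝ, |t| < t₀ → t * ρ ≤ t ^ 2 * C) : ρ = 0 := by
  have h1 : ∀ᶠ t : ℝ in 𝓝[>] 0, |t| < t₀ := by
    have : ∀ᶠ t : ℝ in 𝓝 0, |t| < t₀ := by
      have := continuous_abs.tendsto (0 : ℝ)
      rw [abs_zero] at this
      exact this.eventually (gt_mem_nhds ht₀)
    exact this.filter_mono nhdsWithin_le_nhds
  have hlim : ∀ c : ℝ, Tendsto (fun t : ℝ => t * c) (𝓝[>] 0) (𝓝 0) := fun c => by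
    have := (continuous_mul_const c).tendsto 0
    rw [zero_mul] at this
    exact this.mono_left nhdsWithin_le_nhds
  refine le_antisymm (ge_of_tendsto (hlim C) ?_) ?_
  · filter_upwards [h1, self_mem_nhdsWithin] with t h2 (h3 : 0 < t)
    have := h t h2
    nlinarith
  · rw [← neg_nonpos]
    refine ge_of_tendsto (hlim C) ?_
    filter_upwards [h1, self_mem_nhdsWithin] with t h2 (h3 : 0 < t)
    have := h (-t) (by rwa [abs_neg])
    nlinarith

/-- The first-order condition for a minimum of the `L²` distance. The remainder of the variation
need not be measurable. -/
theorem sum_integral_re_eq_zero_of_min {ι α : Type*} [Fintype ι] [MeasurableSpace α]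
    {μ : Measure α} {f g : ι → α → ℂ} {b : α → ℝ} (hf : ∀ i, MemLp (f i) 2 μ)
    (hg : ∀ i, MemLp (g i) 2 μ) (hb : Integrable b μ) {t₀ : ℝ} (ht₀ : 0 < t₀)
    (h : ∀ t : ℝ, |t| < t₀ → ∃ R : ι → α → ℂ, (∀ i x, ‖R i x‖ ^ 2 ≤ b x) ∧
      ∫⁻ x, ∑ i, ‖f i x‖ₑ ^ 2 ∂μ ≤
        ∫⁻ x, ∑ i, ‖f i x - (t * g i x + t ^ 2 * R i x)‖ₑ ^ 2 ∂μ) :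
    ∑ i, ∫ x, (conj (f i x) * g i x).re ∂μ = 0 := by
  have hsq : ∀ {u : α → ℂ}, MemLp u 2 μ → Integrable (fun x => ‖u x‖ ^ 2) μ := fun hu =>
    (memLp_two_iff_integrable_sq_norm hu.1).1 hu
  have hre : ∀ i, Integrable (fun x => (conj (f i x) * g i x).re) μ := fun i =>
    ((hf i).star.integrable_mul (hg i)).re
  have hrem : ∀ i, Integrable (fun x => 2 * ‖f i x‖ ^ 2 + 3 * ‖g i x‖ ^ 2 + 2 * b x) μ := fun i =>
    (((hsq (hf i)).const_mul 2).add ((hsq (hg i)).const_mul 3)).add (hb.const_mul 2)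
  refine eq_zero_of_forall_mul_le_sq_mul (t₀ := min t₀ 1)
    (C := (∑ i, ∫ x, (2 * ‖f i x‖ ^ 2 + 3 * ‖g i x‖ ^ 2 + 2 * b x) ∂μ) / 2)
    (lt_min ht₀ one_pos) fun t ht => ?_
  obtain ⟨R, hR, hmin⟩ := h t (ht.trans_le (min_le_left _ _))
  have ht1 : |t| ≤ 1 := (ht.trans_le (min_le_right _ _)).le
  -- An integrable majorant of the perturbed square that does not contain `R`; comparing lower
  -- integrals with it avoids any measurability of `R`.
  let Φ : ι → α → ℝ := fun i x => ‖f i x‖ ^ 2 - 2 * t * (conj (f i x) * g i x).re +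
      t ^ 2 * (2 * ‖f i x‖ ^ 2 + 3 * ‖g i x‖ ^ 2 + 2 * b x)
  have hΦ : ∀ i x, ‖f i x - (t * g i x + t ^ 2 * R i x)‖ ^ 2 ≤ Φ i x := fun i x =>
    norm_sub_add_sq_le ht1 (hR i x)
  have hΦ0 : ∀ i x, 0 ≤ Φ i x := fun i x => (sq_nonneg _).trans (hΦ i x)
  have hΦint : ∀ i, Integrable (Φ i) μ := fun i =>
    ((hsq (hf i)).sub ((hre i).const_mul _)).add ((hrem i).const_mul _)
  have hLHS : ∫⁻ x, ∑ i, ‖f i x‖ₑ ^ 2 ∂μ = ENNReal.ofReal (∑ i, ∫ x, ‖f i x‖ ^ 2 ∂μ) := by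
    rw [← integral_finsetSum _ fun i _ => hsq (hf i), ofReal_integral_eq_lintegral_ofReal
      (integrable_finsetSum _ fun i _ => hsq (hf i))
      (Eventually.of_forall fun x => Finset.sum_nonneg fun i _ => sq_nonneg _)]
    refine lintegral_congr fun x => ?_
    rw [ENNReal.ofReal_sum_of_nonneg fun i _ => sq_nonneg _]
    refine Finset.sum_congr rfl fun i _ => ?_
    rw [ENNReal.ofReal_pow (norm_nonneg _), ofReal_norm]
  have hRHS : ∫⁻ x, ∑ i, ‖f i x - (t * g i x + t ^ 2 * R i x)‖ₑ ^ 2 ∂μ ≤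
      ENNReal.ofReal (∑ i, ∫ x, Φ i x ∂μ) := by
    rw [← integral_finsetSum _ fun i _ => hΦint i, ofReal_integral_eq_lintegral_ofReal
      (integrable_finsetSum _ fun i _ => hΦint i)
      (Eventually.of_forall fun x => Finset.sum_nonneg fun i _ => hΦ0 i x)]
    refine lintegral_mono fun x => ?_
    dsimp only
    rw [ENNReal.ofReal_sum_of_nonneg fun i _ => hΦ0 i x]
    refine Finset.sum_le_sum fun i _ => ?_
    rw [← ofReal_norm, ← ENNReal.ofReal_pow (norm_nonneg _)]
    exact ENNReal.ofReal_le_ofReal (hΦ i x)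
  have hcmp := (ENNReal.ofReal_le_ofReal_iff
    (Finset.sum_nonneg fun i _ => integral_nonneg (hΦ0 i))).1 (hLHS ▸ hmin.trans hRHS)
  have hexp : ∀ i, ∫ x, Φ i x ∂μ = ∫ x, ‖f i x‖ ^ 2 ∂μ -
      2 * t * ∫ x, (conj (f i x) * g i x).re ∂μ +
      t ^ 2 * ∫ x, (2 * ‖f i x‖ ^ 2 + 3 * ‖g i x‖ ^ 2 + 2 * b x) ∂μ := fun i => by
    have hsub : Integrable (fun x => ‖f i x‖ ^ 2 - 2 * t * (conj (f i x) * g i x).re) μ :=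
      (hsq (hf i)).sub ((hre i).const_mul _)
    rw [integral_add hsub ((hrem i).const_mul _),
      integral_sub (hsq (hf i)) ((hre i).const_mul _), integral_const_mul, integral_const_mul]
  simp only [hexp, Finset.sum_add_distrib, Finset.sum_sub_distrib, ← Finset.mul_sum] at hcmp
  linarith

/-! ### The bilinear pairing on the imaginary axis. -/

section Pairing

open scoped Matrix.Norms.Operator

variable {l m n p q : ℕ}

theorem norm_entry_le_norm (M : Matrix (Fin p) (Fin m) ℂ) (i : Fin p) (j : Fin m) :
    ‖M i j‖ ≤ ‖M‖ := by
  rw [Matrix.linfty_opNorm_def]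
  have h1 : ‖M i j‖₊ ≤ ∑ j, ‖M i j‖₊ :=
    Finset.single_le_sum (f := fun j => ‖M i j‖₊) (fun _ _ => zero_le) (Finset.mem_univ j)
  have h2 : ∑ j, ‖M i j‖₊ ≤ Finset.univ.sup fun i => ∑ j, ‖M i j‖₊ :=
    Finset.le_sup (f := fun i => ∑ j, ‖M i j‖₊) (Finset.mem_univ i)
  exact_mod_cast h1.trans h2

theorem norm_le_sum_norm_entry (M : Matrix (Fin p) (Fin m) ℂ) :
    ‖M‖ ≤ ∑ i, ∑ j, ‖M i j‖ := by
  rw [Matrix.linfty_opNorm_def]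
  have : (Finset.univ.sup fun i => ∑ j, ‖M i j‖₊) ≤ ∑ i, ∑ j, ‖M i j‖₊ :=
    Finset.sup_le fun i _ => Finset.single_le_sum (f := fun i => ∑ j, ‖M i j‖₊)
      (fun _ _ => zero_le) (Finset.mem_univ i)
  exact (NNReal.coe_le_coe.2 this).trans_eq (by push_cast; rfl)

theorem one_le_sqrt_one_add_sq (ω : ℝ) : 1 ≤ √(1 + ω ^ 2) := by
  rw [Real.one_le_sqrt]
  nlinarith [sq_nonneg ω]

theorem sq_le_of_mul_sqrt_le {a K ω : ℝ} (ha : 0 ≤ a) (h : a * √(1 + ω ^ 2) ≤ K) :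
    a ^ 2 ≤ K ^ 2 * (1 + ω ^ 2)⁻¹ := by
  have hpos : 0 < 1 + ω ^ 2 := by positivity
  rw [← div_eq_mul_inv, le_div_iff₀ hpos]
  calc a ^ 2 * (1 + ω ^ 2) = (a * √(1 + ω ^ 2)) ^ 2 := by
        rw [mul_pow, Real.sq_sqrt hpos.le]
    _ ≤ K ^ 2 := pow_le_pow_left₀ (by positivity) h 2

/-- A matrix function that is continuous on the imaginary axis and decays there like `1 / |s|`. -/
def AxisDecay (G : ℂ → Matrix (Fin p) (Fin m) ℂ) : Prop :=
  (Continuous fun ω : ℝ => G (Complex.I * (ω : ℂ))) ∧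
    ∃ K : ℝ, ∀ ω : ℝ, ‖G (Complex.I * (ω : ℂ))‖ * √(1 + ω ^ 2) ≤ K

theorem AxisDecay.memLp {G : ℂ → Matrix (Fin p) (Fin m) ℂ} (hG : AxisDecay G) (i : Fin p)
    (j : Fin m) : MemLp (fun ω : ℝ => G (Complex.I * (ω : ℂ)) i j) 2 volume := by
  obtain ⟨hc, K, hK⟩ := hG
  have hc' : Continuous fun ω : ℝ => G (Complex.I * (ω : ℂ)) i j := hc.matrix_elem i j
  rw [memLp_two_iff_integrable_sq_norm hc'.aestronglyMeasurable]
  refine (integrable_inv_one_add_sq.const_mul (K ^ 2)).mono'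
    (hc'.norm.pow 2).aestronglyMeasurable (Eventually.of_forall fun ω => ?_)
  rw [Real.norm_of_nonneg (sq_nonneg _)]
  exact (pow_le_pow_left₀ (norm_nonneg _) (norm_entry_le_norm _ i j) 2).trans
    (sq_le_of_mul_sqrt_le (norm_nonneg _) (hK ω))

theorem AxisDecay.const_mul {G : ℂ → Matrix (Fin p) (Fin m) ℂ} (hG : AxisDecay G)
    (M : Matrix (Fin l) (Fin p) ℂ) : AxisDecay fun s => M * G s := by
  obtain ⟨hc, K, hK⟩ := hG
  refine ⟨continuous_const.matrix_mul hc, ‖M‖ * K, fun ω => ?_⟩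
  calc ‖M * G (Complex.I * (ω : ℂ))‖ * √(1 + ω ^ 2)
      ≤ ‖M‖ * ‖G (Complex.I * (ω : ℂ))‖ * √(1 + ω ^ 2) := by
        gcongr
        exact Matrix.linfty_opNorm_mul _ _
    _ ≤ ‖M‖ * K := by
        rw [mul_assoc]
        gcongr
        exact hK ω

theorem AxisDecay.mul_const {G : ℂ → Matrix (Fin p) (Fin m) ℂ} (hG : AxisDecay G)
    (M : Matrix (Fin m) (Fin l) ℂ) : AxisDecay fun s => G s * M := by
  obtain ⟨hc, K, hK⟩ := hG
  refine ⟨hc.matrix_mul continuous_const, K * ‖M‖, fun ω => ?_⟩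
  calc ‖G (Complex.I * (ω : ℂ)) * M‖ * √(1 + ω ^ 2)
      ≤ ‖G (Complex.I * (ω : ℂ))‖ * ‖M‖ * √(1 + ω ^ 2) := by
        gcongr
        exact Matrix.linfty_opNorm_mul _ _
    _ = ‖G (Complex.I * (ω : ℂ))‖ * √(1 + ω ^ 2) * ‖M‖ := by ring
    _ ≤ K * ‖M‖ := by
        gcongr
        exact hK ω

theorem AxisDecay.norm_le {G : ℂ → Matrix (Fin p) (Fin m) ℂ} {K ω : ℝ}
    (h : ‖G (Complex.I * (ω : ℂ))‖ * √(1 + ω ^ 2) ≤ K) : ‖G (Complex.I * (ω : ℂ))‖ ≤ K :=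
  (le_mul_of_one_le_right (norm_nonneg _) (one_le_sqrt_one_add_sq ω)).trans h

theorem AxisDecay.mul {G : ℂ → Matrix (Fin p) (Fin m) ℂ} {G' : ℂ → Matrix (Fin m) (Fin l) ℂ}
    (hG : AxisDecay G) (hG' : AxisDecay G') : AxisDecay fun s => G s * G' s := by
  obtain ⟨hc, K, hK⟩ := hG
  obtain ⟨hc', K', hK'⟩ := hG'
  refine ⟨hc.matrix_mul hc', K * K', fun ω => ?_⟩
  have hK0 : 0 ≤ K := (mul_nonneg (norm_nonneg _) (Real.sqrt_nonneg _)).trans (hK 0)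
  calc ‖G (Complex.I * (ω : ℂ)) * G' (Complex.I * (ω : ℂ))‖ * √(1 + ω ^ 2)
      ≤ ‖G (Complex.I * (ω : ℂ))‖ * ‖G' (Complex.I * (ω : ℂ))‖ * √(1 + ω ^ 2) := by
        gcongr
        exact Matrix.linfty_opNorm_mul _ _
    _ = ‖G (Complex.I * (ω : ℂ))‖ * (‖G' (Complex.I * (ω : ℂ))‖ * √(1 + ω ^ 2)) := by ring
    _ ≤ K * K' := mul_le_mul (AxisDecay.norm_le (hK ω)) (hK' ω) (by positivity) hK0

/-- The bilinear pairing `∑ ∫ Eᵢⱼ(-iω) Gᵢⱼ(iω) dω` of matrix functions on the imaginary axis. -/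
noncomputable def axisPairing (E G : ℂ → Matrix (Fin p) (Fin m) ℂ) : ℂ :=
  ∑ i, ∑ j, ∫ ω : ℝ, E (Complex.I * ((-ω : ℝ) : ℂ)) i j * G (Complex.I * (ω : ℂ)) i j

variable {E G : ℂ → Matrix (Fin p) (Fin m) ℂ}

theorem MemH2.memLp_neg (hE : MemH2 E) (i : Fin p) (j : Fin m) :
    MemLp (fun ω : ℝ => E (Complex.I * ((-ω : ℝ) : ℂ)) i j) 2 volume :=
  (hE.entry i j).memLp_boundary.comp_measurePreserving
    (Measure.measurePreserving_neg (volume : Measure ℝ))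

theorem MemH2.integrable_pairing (hE : MemH2 E) (hG : AxisDecay G) (i : Fin p) (j : Fin m) :
    Integrable fun ω : ℝ => E (Complex.I * ((-ω : ℝ) : ℂ)) i j * G (Complex.I * (ω : ℂ)) i j :=
  (hE.memLp_neg i j).integrable_mul (hG.memLp i j)

/-- The pairing has no conjugation, so it is complex linear in `G`. Vanishing for real perturbation
matrices thus extends to complex ones. -/
theorem axisPairing_add_I_smul (hE : MemH2 E) {G₁ G₂ : ℂ → Matrix (Fin p) (Fin m) ℂ}
    (h₁ : AxisDecay G₁) (h₂ : AxisDecay G₂) (h : ∀ s, G s = G₁ s + Complex.I • G₂ s) :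
    axisPairing E G = axisPairing E G₁ + Complex.I * axisPairing E G₂ := by
  simp only [axisPairing, Finset.mul_sum, ← Finset.sum_add_distrib]
  refine Finset.sum_congr rfl fun i _ => Finset.sum_congr rfl fun j _ => ?_
  rw [← integral_const_mul, ← integral_add (hE.integrable_pairing h₁ i j)
    ((hE.integrable_pairing h₂ i j).const_mul _)]
  refine integral_congr_ae (Eventually.of_forall fun ω => ?_)
  simp only [h, Matrix.add_apply, Matrix.smul_apply, smul_eq_mul]
  ring

/-- Symmetry under complex conjugation on the imaginary axis. -/
def AxisReal (G : ℂ → Matrix (Fin p) (Fin m) ℂ) : Prop :=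
  ∀ ω : ℝ, G (Complex.I * ((-ω : ℝ) : ℂ)) = (G (Complex.I * (ω : ℂ))).map (starRingEnd ℂ)

/-- Conjugation amounts to the substitution `ω ↦ -ω`. The pairing of real functions is therefore
real. -/
theorem conj_axisPairing (hE : MemH2 E) (hreal : IsRealTransfer E) (hG : AxisReal G) :
    conj (axisPairing E G) = axisPairing E G := by
  simp only [axisPairing, map_sum]
  refine Finset.sum_congr rfl fun i _ => Finset.sum_congr rfl fun j _ => ?_
  rw [← integral_conj, ← integral_neg_eq_self (fun ω : ℝ =>
    E (Complex.I * ((-ω : ℝ) : ℂ)) i j * G (Complex.I * (ω : ℂ)) i j)]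
  refine integral_congr_ae ?_
  filter_upwards [hreal.ae_axis hE i j] with ω h1
  rw [hG ω, map_mul, h1, neg_neg, Complex.conj_conj, Matrix.map_apply]

/-- For real `E` the value at `-iω` is the conjugate of the value at `iω`, so the pairing is the
`L²` inner product that occurs in the first-order condition. -/
theorem re_axisPairing (hE : MemH2 E) (hreal : IsRealTransfer E) (hG : AxisDecay G) :
    (axisPairing E G).re = ∑ ij : Fin p × Fin m, ∫ ω : ℝ,
      (conj (E (Complex.I * (ω : ℂ)) ij.1 ij.2) * G (Complex.I * (ω : ℂ)) ij.1 ij.2).re := by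
  rw [Fintype.sum_prod_type]
  simp only [axisPairing, Complex.re_sum]
  refine Finset.sum_congr rfl fun i _ => Finset.sum_congr rfl fun j _ => ?_
  have h := integral_re (hE.integrable_pairing hG i j)
  rw [RCLike.re_eq_complex_re] at h
  rw [← h]
  refine integral_congr_ae ?_
  filter_upwards [hreal.ae_axis hE i j] with ω h1
  rw [h1]

theorem h2Norm_le_iff {G₁ G₂ : ℂ → Matrix (Fin p) (Fin m) ℂ} :
    h2Norm G₁ ≤ h2Norm G₂ ↔ ∫⁻ ω : ℝ, frobeniusSq (G₁ (Complex.I * (ω : ℂ))) ≤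
      ∫⁻ ω : ℝ, frobeniusSq (G₂ (Complex.I * (ω : ℂ))) := by
  unfold h2Norm
  rw [ENNReal.rpow_le_rpow_iff (by norm_num), ENNReal.mul_le_mul_iff_right]
  · simp [Real.pi_pos]
  · simp

theorem frobeniusSq_eq_sum_prod (M : Matrix (Fin p) (Fin m) ℂ) :
    frobeniusSq M = ∑ ij : Fin p × Fin m, ‖M ij.1 ij.2‖ₑ ^ 2 := by
  rw [Fintype.sum_prod_type]
  rfl

/-- The first-order optimality condition: the error of a best approximation pairs to zero with
every tangent direction. -/
theorem IsBestH2Approx.axisPairing_eq_zero {r : ℕ} {H : ℂ → Matrix (Fin p) (Fin m) ℂ}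
    {S : LTISystem r m p} (hbest : IsBestH2Approx H S) (hH : MemH2 H) (hreal : IsRealTransfer H)
    (hG : AxisDecay G) (hGreal : AxisReal G) (T : ℝ → LTISystem r m p) {t₀ K : ℝ}
    (ht₀ : 0 < t₀) (hstable : ∀ t : ℝ, |t| < t₀ → (T t).IsStable)
    (hT : ∀ t : ℝ, |t| < t₀ → ∀ ω : ℝ, ∃ R : Matrix (Fin p) (Fin m) ℂ,
      ‖R‖ * √(1 + ω ^ 2) ≤ K ∧ (T t).transfer (Complex.I * (ω : ℂ)) =
        S.transfer (Complex.I * (ω : ℂ)) + (t : ℂ) • G (Complex.I * (ω : ℂ)) +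
          (t : ℂ) ^ 2 • R) :
    axisPairing (fun s => H s - S.transfer s) G = 0 := by
  set E : ℂ → Matrix (Fin p) (Fin m) ℂ := fun s => H s - S.transfer s with hEdef
  have hE : MemH2 E := hH.sub hbest.1.memH2
  have hEr : IsRealTransfer E := hreal.sub hbest.1.isRealTransfer
  have hre : (axisPairing E G).re = 0 := by
    rw [re_axisPairing hE hEr hG]
    refine sum_integral_re_eq_zero_of_min (ι := Fin p × Fin m)
      (f := fun ij (ω : ℝ) => E (Complex.I * (ω : ℂ)) ij.1 ij.2)
      (g := fun ij (ω : ℝ) => G (Complex.I * (ω : ℂ)) ij.1 ij.2)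
      (fun ij => (hE.entry ij.1 ij.2).memLp_boundary) (fun ij => hG.memLp ij.1 ij.2)
      (integrable_inv_one_add_sq.const_mul (K ^ 2)) ht₀ fun t ht => ?_
    choose R hR hTR using hT t ht
    refine ⟨fun ij ω => R ω ij.1 ij.2, fun ij ω => ?_, ?_⟩
    · exact (pow_le_pow_left₀ (norm_nonneg _) (norm_entry_le_norm _ _ _) 2).trans
        (sq_le_of_mul_sqrt_le (norm_nonneg _) (hR ω))
    · have h1 := h2Norm_le_iff.1 (hbest.2 (T t) (hstable t ht))
      simp only [frobeniusSq_eq_sum_prod] at h1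
      refine h1.trans (le_of_eq (lintegral_congr fun ω => Finset.sum_congr rfl fun ij _ => ?_))
      rw [hTR ω]
      congr 2
      simp only [hEdef, Matrix.sub_apply, Matrix.add_apply, Matrix.smul_apply, smul_eq_mul]
      ring
  have him : (axisPairing E G).im = 0 := Complex.conj_eq_iff_im.1 (conj_axisPairing hE hEr hGreal)
  exact Complex.ext hre him

end Pairing

/-! ### Tangent directions from perturbing the system matrices. -/

section Variations

open scoped Matrix.Norms.Operator

variable {l m n p r : ℕ}

theorem AxisReal.const_mul {G : ℂ → Matrix (Fin p) (Fin m) ℂ} (hG : AxisReal G)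
    (M : Matrix (Fin l) (Fin p) ℝ) : AxisReal fun s => M.map Complex.ofReal * G s := by
  intro ω
  simp only [hG ω, Matrix.map_mul]
  congr 1
  ext i j
  simp

theorem AxisReal.mul_const {G : ℂ → Matrix (Fin p) (Fin m) ℂ} (hG : AxisReal G)
    (M : Matrix (Fin m) (Fin l) ℝ) : AxisReal fun s => G s * M.map Complex.ofReal := by
  intro ω
  simp only [hG ω, Matrix.map_mul]
  congr 1
  ext i j
  simp

theorem AxisReal.mul {G : ℂ → Matrix (Fin p) (Fin m) ℂ} {G' : ℂ → Matrix (Fin m) (Fin l) ℂ}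
    (hG : AxisReal G) (hG' : AxisReal G') : AxisReal fun s => G s * G' s := by
  intro ω
  simp only [hG ω, hG' ω, Matrix.map_mul]

namespace LTISystem

/-- Lets the decay and differentiability of transfer functions be applied to the resolvent. -/
theorem resolvent_eq_transfer (S : LTISystem n m p) (s : ℂ) :
    (S.pencil s)⁻¹ = (LTISystem.mk S.E S.A 1 1 : LTISystem n n n).transfer s := by
  have h1 : (1 : Matrix (Fin n) (Fin n) ℝ).map Complex.ofReal = 1 := by simp
  simp only [transfer, h1, Matrix.one_mul, Matrix.mul_one]
  rfl

variable {S : LTISystem n m p}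

theorem IsStable.of_eq (hS : S.IsStable) (B : Matrix (Fin n) (Fin l) ℝ)
    (C : Matrix (Fin r) (Fin n) ℝ) : (LTISystem.mk S.E S.A B C).IsStable :=
  ⟨hS.isUnit_det, hS.re_neg⟩

theorem IsStable.exists_norm_resolvent_le (hS : S.IsStable) :
    ∃ K : ℝ, ∀ s : ℂ, 0 ≤ s.re → ‖(S.pencil s)⁻¹‖ * √(1 + ‖s‖ ^ 2) ≤ K := by
  have h1 := hS.of_eq (1 : Matrix (Fin n) (Fin n) ℝ) (1 : Matrix (Fin n) (Fin n) ℝ)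
  choose K hK using fun i j => h1.exists_bound i j
  refine ⟨∑ i, ∑ j, √(K i j), fun s hs => ?_⟩
  refine (mul_le_mul_of_nonneg_right (norm_le_sum_norm_entry _) (Real.sqrt_nonneg _)).trans ?_
  simp only [Finset.sum_mul]
  refine Finset.sum_le_sum fun i _ => Finset.sum_le_sum fun j _ => ?_
  rw [resolvent_eq_transfer]
  have h := hK i j s hs
  have hpos : 0 < 1 + ‖s‖ ^ 2 := by positivity
  rw [← div_eq_mul_inv, le_div_iff₀ hpos] at h
  refine Real.le_sqrt_of_sq_le ?_
  rwa [mul_pow, Real.sq_sqrt hpos.le]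

theorem IsStable.axisDecay_resolvent (hS : S.IsStable) : AxisDecay fun s => (S.pencil s)⁻¹ := by
  obtain ⟨K, hK⟩ := hS.exists_norm_resolvent_le
  refine ⟨?_, K, fun ω => ?_⟩
  · refine continuous_matrix fun i j => ?_
    simp only [resolvent_eq_transfer]
    rw [continuous_iff_continuousAt]
    intro ω
    have h1 := ((hS.of_eq (1 : Matrix (Fin n) (Fin n) ℝ)
      (1 : Matrix (Fin n) (Fin n) ℝ)).differentiableAt
      (s := Complex.I * (ω : ℂ)) (by simp) i j).continuousAt
    exact ContinuousAt.comp (f := fun ω : ℝ => Complex.I * (ω : ℂ)) h1 (by fun_prop)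
  · simpa using hK (Complex.I * (ω : ℂ)) (by simp)

theorem IsStable.axisReal_resolvent (hS : S.IsStable) : AxisReal fun s => (S.pencil s)⁻¹ := by
  intro ω
  have hu : IsUnit (S.pencil (Complex.I * (ω : ℂ))).det := hS.isUnit_pencil_det (by simp)
  have hp : S.pencil (Complex.I * ((-ω : ℝ) : ℂ)) =
      (S.pencil (Complex.I * (ω : ℂ))).map (starRingEnd ℂ) := by
    ext i j
    simp [pencil]
  simp only [hp]
  refine Matrix.inv_eq_left_inv ?_
  rw [← Matrix.map_mul, Matrix.nonsing_inv_mul _ hu]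
  simp

end LTISystem

theorem eq_map_re_add_I_smul_map_im (Z : Matrix (Fin p) (Fin m) ℂ) :
    Z = (Z.map Complex.re).map Complex.ofReal +
      Complex.I • (Z.map Complex.im).map Complex.ofReal := by
  ext i j
  simp [mul_comm Complex.I, Complex.re_add_im]

variable {H : ℂ → Matrix (Fin p) (Fin m) ℂ} {S : LTISystem r m p}

/-- The transfer function is affine in `B` and stability does not involve `B`, so the remainder is
zero and every real direction is admissible; complex `Z` follows by linearity. -/
theorem IsBestH2Approx.axisPairing_input (hbest : IsBestH2Approx H S) (hH : MemH2 H)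
    (hreal : IsRealTransfer H) (Z : Matrix (Fin r) (Fin m) ℂ) :
    axisPairing (fun s => H s - S.transfer s)
      (fun s => S.C.map Complex.ofReal * (S.pencil s)⁻¹ * Z) = 0 := by
  have hCQ := hbest.1.axisDecay_resolvent.const_mul (S.C.map Complex.ofReal)
  have hreal' : ∀ X : Matrix (Fin r) (Fin m) ℝ, axisPairing (fun s => H s - S.transfer s)
      (fun s => S.C.map Complex.ofReal * (S.pencil s)⁻¹ * X.map Complex.ofReal) = 0 := by
    intro X
    refine hbest.axisPairing_eq_zero hH hreal (hCQ.mul_const _)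
      ((hbest.1.axisReal_resolvent.const_mul _).mul_const _)
      (fun t => ⟨S.E, S.A, S.B + t • X, S.C⟩) (K := 0) one_pos
      (fun t _ => hbest.1.of_eq _ _) fun t _ ω => ⟨0, by simp, ?_⟩
    have h1 : (S.B + t • X).map Complex.ofReal =
        S.B.map Complex.ofReal + (t : ℂ) • X.map Complex.ofReal := by
      ext i j
      simp
    simp only [LTISystem.transfer, h1, Matrix.mul_add, Matrix.mul_smul, smul_zero, add_zero]
    rfl
  rw [axisPairing_add_I_smul (hH.sub hbest.1.memH2)
    (hCQ.mul_const ((Z.map Complex.re).map Complex.ofReal))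
    (hCQ.mul_const ((Z.map Complex.im).map Complex.ofReal)) fun s => ?_, hreal', hreal']
  · simp
  · rw [← Matrix.mul_smul, ← Matrix.mul_add, ← eq_map_re_add_I_smul_map_im]

theorem IsBestH2Approx.axisPairing_output (hbest : IsBestH2Approx H S) (hH : MemH2 H)
    (hreal : IsRealTransfer H) (Z : Matrix (Fin p) (Fin r) ℂ) :
    axisPairing (fun s => H s - S.transfer s)
      (fun s => Z * ((S.pencil s)⁻¹ * S.B.map Complex.ofReal)) = 0 := by
  have hQB := hbest.1.axisDecay_resolvent.mul_const (S.B.map Complex.ofReal)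
  have hreal' : ∀ X : Matrix (Fin p) (Fin r) ℝ, axisPairing (fun s => H s - S.transfer s)
      (fun s => X.map Complex.ofReal * ((S.pencil s)⁻¹ * S.B.map Complex.ofReal)) = 0 := by
    intro X
    refine hbest.axisPairing_eq_zero hH hreal (hQB.const_mul _)
      ((hbest.1.axisReal_resolvent.mul_const _).const_mul _)
      (fun t => ⟨S.E, S.A, S.B, S.C + t • X⟩) (K := 0) one_pos
      (fun t _ => hbest.1.of_eq _ _) fun t _ ω => ⟨0, by simp, ?_⟩
    have h1 : (S.C + t • X).map Complex.ofReal =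
        S.C.map Complex.ofReal + (t : ℂ) • X.map Complex.ofReal := by
      ext i j
      simp
    simp only [LTISystem.transfer, h1, Matrix.add_mul, Matrix.smul_mul, smul_zero, add_zero,
      Matrix.mul_assoc]
    rfl
  rw [axisPairing_add_I_smul (hH.sub hbest.1.memH2)
    (hQB.const_mul ((Z.map Complex.re).map Complex.ofReal))
    (hQB.const_mul ((Z.map Complex.im).map Complex.ofReal)) fun s => ?_, hreal', hreal']
  · simp
  · rw [← Matrix.smul_mul, ← Matrix.add_mul, ← eq_map_re_add_I_smul_map_im]

/-- Factor out `P` and invert `1 - t P⁻¹ D` by the Neumann series. -/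
theorem isUnit_sub_smul {P D : Matrix (Fin n) (Fin n) ℂ} (hP : IsUnit P.det) {t : ℂ}
    (ht : ‖t‖ * (‖P⁻¹‖ * ‖D‖) ≤ 1 / 2) : IsUnit (P - t • D).det := by
  have : CompleteSpace (Matrix (Fin n) (Fin n) ℂ) := FiniteDimensional.complete ℂ _
  have h1 : ‖t • (P⁻¹ * D)‖ < 1 := by
    rw [norm_smul]
    refine lt_of_le_of_lt (mul_le_mul_of_nonneg_left (Matrix.linfty_opNorm_mul _ _)
      (norm_nonneg _)) (ht.trans_lt (by norm_num))
  have h2 : P - t • D = P * (1 - t • (P⁻¹ * D)) := by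
    rw [Matrix.mul_sub, Matrix.mul_one, Matrix.mul_smul, ← Matrix.mul_assoc,
      Matrix.mul_nonsing_inv _ hP, Matrix.one_mul]
  rw [h2, Matrix.det_mul]
  exact hP.mul ((Matrix.isUnit_iff_isUnit_det _).1 (isUnit_one_sub_of_norm_lt_one h1))

theorem inv_sub_smul_eq {P D : Matrix (Fin n) (Fin n) ℂ} (hP : IsUnit P.det) {t : ℂ}
    (h : IsUnit (P - t • D).det) : (P - t • D)⁻¹ = P⁻¹ + t • (P⁻¹ * D * (P - t • D)⁻¹) := by
  have h1 : P⁻¹ * (P - t • D) * (P - t • D)⁻¹ = P⁻¹ := by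
    rw [Matrix.mul_assoc, Matrix.mul_nonsing_inv _ h, Matrix.mul_one]
  rw [Matrix.mul_sub, Matrix.nonsing_inv_mul _ hP, Matrix.sub_mul, Matrix.one_mul,
    Matrix.mul_smul, Matrix.smul_mul] at h1
  exact sub_eq_iff_eq_add.1 h1

theorem norm_inv_sub_smul_le {P D : Matrix (Fin n) (Fin n) ℂ} (hP : IsUnit P.det) {t : ℂ}
    (ht : ‖t‖ * (‖P⁻¹‖ * ‖D‖) ≤ 1 / 2) : ‖(P - t • D)⁻¹‖ ≤ 2 * ‖P⁻¹‖ := by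
  have h := inv_sub_smul_eq hP (isUnit_sub_smul hP ht)
  set W := (P - t • D)⁻¹
  have h1 : ‖t • (P⁻¹ * D * W)‖ ≤ 1 / 2 * ‖W‖ := by
    rw [norm_smul]
    calc ‖t‖ * ‖P⁻¹ * D * W‖ ≤ ‖t‖ * (‖P⁻¹‖ * ‖D‖ * ‖W‖) := by
          gcongr
          exact (Matrix.linfty_opNorm_mul _ _).trans (mul_le_mul_of_nonneg_right
            (Matrix.linfty_opNorm_mul _ _) (norm_nonneg _))
      _ = ‖t‖ * (‖P⁻¹‖ * ‖D‖) * ‖W‖ := by ring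
      _ ≤ _ := by gcongr
  have h2 : ‖W‖ ≤ ‖P⁻¹‖ + ‖t • (P⁻¹ * D * W)‖ := by
    conv_lhs => rw [h]
    exact norm_add_le _ _
  linarith

/-- Perturbing `A` is nonlinear, but the resolvent is bounded on the closed right half-plane. Hence
small perturbations keep the system stable, and the second-order remainder is uniformly bounded with
decay along the axis. -/
theorem IsBestH2Approx.axisPairing_state (hbest : IsBestH2Approx H S) (hH : MemH2 H)
    (hreal : IsRealTransfer H) (Z : Matrix (Fin r) (Fin r) ℂ) :
    axisPairing (fun s => H s - S.transfer s)
      (fun s => S.C.map Complex.ofReal * (S.pencil s)⁻¹ * Z *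
        ((S.pencil s)⁻¹ * S.B.map Complex.ofReal)) = 0 := by
  have hCQ := hbest.1.axisDecay_resolvent.const_mul (S.C.map Complex.ofReal)
  have hQB := hbest.1.axisDecay_resolvent.mul_const (S.B.map Complex.ofReal)
  have hreal' : ∀ X : Matrix (Fin r) (Fin r) ℝ, axisPairing (fun s => H s - S.transfer s)
      (fun s => S.C.map Complex.ofReal * (S.pencil s)⁻¹ * X.map Complex.ofReal *
        ((S.pencil s)⁻¹ * S.B.map Complex.ofReal)) = 0 := by
    intro X
    obtain ⟨K, hK⟩ := hbest.1.exists_norm_resolvent_le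
    have hK0 : 0 ≤ K := (mul_nonneg (norm_nonneg _) (Real.sqrt_nonneg _)).trans (hK 0 (by simp))
    have hKn : ∀ s : ℂ, 0 ≤ s.re → ‖(S.pencil s)⁻¹‖ ≤ K := fun s hs =>
      (le_mul_of_one_le_right (norm_nonneg _) (one_le_sqrt_one_add_sq _)).trans (hK s hs)
    set D := X.map Complex.ofReal with hD
    -- Makes the Neumann condition hold at all points of the closed right half-plane at once; the `+
    -- 1` covers `K * ‖D‖ = 0`.
    set t₀ : ℝ := 1 / (2 * (K * ‖D‖ + 1)) with ht₀def
    have ht₀ : 0 < t₀ := by positivity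
    have hsmall : ∀ t : ℝ, |t| < t₀ → ∀ s : ℂ, 0 ≤ s.re →
        ‖(t : ℂ)‖ * (‖(S.pencil s)⁻¹‖ * ‖D‖) ≤ 1 / 2 := by
      intro t ht s hs
      rw [Complex.norm_real, Real.norm_eq_abs]
      calc |t| * (‖(S.pencil s)⁻¹‖ * ‖D‖) ≤ t₀ * (K * ‖D‖ + 1) := by
            gcongr
            refine le_trans ?_ (le_add_of_nonneg_right zero_le_one)
            gcongr
            exact hKn s hs
        _ = 1 / 2 := by
            rw [ht₀def]
            have : 0 < K * ‖D‖ + 1 := by positivity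
            field_simp
    have hpencil : ∀ (t : ℝ) (s : ℂ),
        (LTISystem.mk S.E (S.A + t • X) S.B S.C : LTISystem r m p).pencil s =
          S.pencil s - (t : ℂ) • D := by
      intro t s
      ext i j
      simp [LTISystem.pencil, hD]
      ring
    refine hbest.axisPairing_eq_zero hH hreal ((hCQ.mul_const _).mul hQB)
      (((hbest.1.axisReal_resolvent.const_mul _).mul_const _).mul
        (hbest.1.axisReal_resolvent.mul_const _))
      (fun t => ⟨S.E, S.A + t • X, S.B, S.C⟩)
      (K := ‖S.C.map Complex.ofReal‖ * K * ‖D‖ * K * ‖D‖ * (2 * K) * ‖S.B.map Complex.ofReal‖)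
      ht₀ (fun t ht => ⟨hbest.1.isUnit_det, fun s hs => ?_⟩) fun t ht ω => ?_
    · by_contra hre
      rw [not_lt] at hre
      rw [hpencil] at hs
      exact (isUnit_sub_smul (hbest.1.isUnit_pencil_det hre) (hsmall t ht s hre)).ne_zero hs
    · have hre : 0 ≤ (Complex.I * (ω : ℂ)).re := by simp
      have hP := hbest.1.isUnit_pencil_det hre
      have hsm := hsmall t ht _ hre
      have hinv := inv_sub_smul_eq hP (isUnit_sub_smul hP hsm)
      have hW := norm_inv_sub_smul_le hP hsm
      have hQ := hK _ hre
      have hQn := hKn _ hre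
      simp only [norm_mul, Complex.norm_I, one_mul, Complex.norm_real, Real.norm_eq_abs,
        sq_abs] at hQ
      simp only [LTISystem.transfer, hpencil]
      set Q := (S.pencil (Complex.I * (ω : ℂ)))⁻¹
      set W := (S.pencil (Complex.I * (ω : ℂ)) - (t : ℂ) • D)⁻¹
      set C := S.C.map Complex.ofReal
      set B := S.B.map Complex.ofReal
      refine ⟨C * Q * D * Q * D * W * B, ?_, ?_⟩
      · have hmul : ∀ {a b c : ℕ} (M : Matrix (Fin a) (Fin b) ℂ) (N : Matrix (Fin b) (Fin c) ℂ)
            {x : ℝ}, ‖M‖ ≤ x → ‖M * N‖ ≤ x * ‖N‖ := fun M N x hx =>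
          (Matrix.linfty_opNorm_mul _ _).trans (mul_le_mul_of_nonneg_right hx (norm_nonneg _))
        have h1 : ‖C * Q * D * Q * D * W * B‖ ≤ ‖C‖ * ‖Q‖ * ‖D‖ * ‖Q‖ * ‖D‖ * ‖W‖ * ‖B‖ :=
          hmul _ _ (hmul _ _ (hmul _ _ (hmul _ _ (hmul _ _ (hmul _ _ le_rfl)))))
        calc ‖C * Q * D * Q * D * W * B‖ * √(1 + ω ^ 2)
            ≤ ‖C‖ * ‖Q‖ * ‖D‖ * ‖Q‖ * ‖D‖ * ‖W‖ * ‖B‖ * √(1 + ω ^ 2) := by gcongr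
          _ = ‖C‖ * (‖Q‖ * √(1 + ω ^ 2)) * ‖D‖ * ‖Q‖ * ‖D‖ * ‖W‖ * ‖B‖ := by ring
          _ ≤ ‖C‖ * K * ‖D‖ * K * ‖D‖ * (2 * K) * ‖B‖ := by
              gcongr
              linarith
      -- The resolvent identity applied twice: an exact second-order expansion.
      · have h2 : W = Q + (t : ℂ) • (Q * D * Q) + (t : ℂ) ^ 2 • (Q * D * Q * D * W) := by
          conv_lhs => rw [hinv, hinv]
          simp only [Matrix.mul_add, Matrix.mul_smul, smul_add, smul_smul, sq, Matrix.mul_assoc,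
            add_assoc]
        conv_lhs => rw [h2]
        simp only [Matrix.mul_add, Matrix.add_mul, Matrix.mul_smul, Matrix.smul_mul,
          Matrix.mul_assoc]
  rw [axisPairing_add_I_smul (hH.sub hbest.1.memH2)
    ((hCQ.mul_const ((Z.map Complex.re).map Complex.ofReal)).mul hQB)
    ((hCQ.mul_const ((Z.map Complex.im).map Complex.ofReal)).mul hQB) fun s => ?_,
    hreal', hreal']
  · simp
  · rw [← Matrix.smul_mul, ← Matrix.add_mul, ← Matrix.mul_smul, ← Matrix.mul_add,
      ← eq_map_re_add_I_smul_map_im]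

end Variations

/-! ### Pairing with simple and double poles. -/

section Evaluation

variable {m p : ℕ} {E G : ℂ → Matrix (Fin p) (Fin m) ℂ}

theorem dotProduct_mulVec_eq_sum (M : Matrix (Fin p) (Fin m) ℂ) (u : Fin p → ℂ)
    (w : Fin m → ℂ) : u ⬝ᵥ (M *ᵥ w) = ∑ i, ∑ j, u i * w j * M i j := by
  simp only [dotProduct, Matrix.mulVec, Finset.mul_sum]
  refine Finset.sum_congr rfl fun i _ => Finset.sum_congr rfl fun j _ => ?_
  ring

/-- After `ω ↦ -ω` the pole factor becomes `(-λ - iω)⁻¹`, the Cauchy kernel at the mirror image `-λ`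
of the pole. -/
theorem axisPairing_simple_pole (hE : MemH2 E) {lam : ℂ} (hlam : lam.re < 0) (u : Fin p → ℂ)
    (w : Fin m → ℂ) (hG : ∀ ω : ℝ, G (Complex.I * (ω : ℂ)) =
      (Complex.I * (ω : ℂ) - lam)⁻¹ • Matrix.vecMulVec u w) :
    axisPairing E G = 2 * Real.pi * (u ⬝ᵥ (E (-lam) *ᵥ w)) := by
  have hz : 0 < (-lam).re := by simpa using hlam
  rw [dotProduct_mulVec_eq_sum, Finset.mul_sum]
  simp only [Finset.mul_sum, axisPairing]
  refine Finset.sum_congr rfl fun i _ => Finset.sum_congr rfl fun j _ => ?_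
  rw [← integral_neg_eq_self, mul_left_comm, ← (hE.entry i j).integral_cauchy hz,
    ← integral_const_mul]
  refine integral_congr_ae (Eventually.of_forall fun ω => ?_)
  simp only [hG, neg_neg, Matrix.smul_apply, Matrix.vecMulVec_apply, smul_eq_mul]
  have : Complex.I * ((-ω : ℝ) : ℂ) - lam = -lam - Complex.I * (ω : ℂ) := by
    push_cast
    ring
  rw [this]
  ring

theorem axisPairing_double_pole (hE : MemH2 E) {lam : ℂ} (hlam : lam.re < 0) (u : Fin p → ℂ)
    (w : Fin m → ℂ) (hG : ∀ ω : ℝ, G (Complex.I * (ω : ℂ)) =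
      ((Complex.I * (ω : ℂ) - lam) ^ 2)⁻¹ • Matrix.vecMulVec u w) :
    axisPairing E G = -(2 * Real.pi) * (u ⬝ᵥ (matrixDeriv E (-lam) *ᵥ w)) := by
  have hz : 0 < (-lam).re := by simpa using hlam
  rw [dotProduct_mulVec_eq_sum, Finset.mul_sum]
  simp only [Finset.mul_sum, axisPairing]
  refine Finset.sum_congr rfl fun i _ => Finset.sum_congr rfl fun j _ => ?_
  rw [← integral_neg_eq_self, mul_left_comm, matrixDeriv, Matrix.of_apply, neg_mul,
    ← (hE.entry i j).integral_cauchy_deriv hz, ← integral_const_mul]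
  refine integral_congr_ae (Eventually.of_forall fun ω => ?_)
  simp only [hG, neg_neg, Matrix.smul_apply, Matrix.vecMulVec_apply, smul_eq_mul]
  have : Complex.I * ((-ω : ℝ) : ℂ) - lam = -lam - Complex.I * (ω : ℂ) := by
    push_cast
    ring
  rw [this]
  ring

end Evaluation

/-! ### Eigenvectors of the pencil and partial fractions. -/

namespace LTISystem

variable {n m p : ℕ} {S : LTISystem n m p}

/-- `x` is a right eigenvector (or zero) of the pencil of `S` at `lam`. -/
def IsRightEigen (S : LTISystem n m p) (lam : ℂ) (x : Fin n → ℂ) : Prop :=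
  S.A.map Complex.ofReal *ᵥ x = lam • (S.E.map Complex.ofReal *ᵥ x)

/-- `y` is a left eigenvector (or zero) of the pencil of `S` at `lam`. -/
def IsLeftEigen (S : LTISystem n m p) (lam : ℂ) (y : Fin n → ℂ) : Prop :=
  y ᵥ* S.A.map Complex.ofReal = lam • (y ᵥ* S.E.map Complex.ofReal)

theorem IsRightEigen.pencil_mulVec {lam : ℂ} {x : Fin n → ℂ} (hx : S.IsRightEigen lam x) (s : ℂ) :
    S.pencil s *ᵥ x = (s - lam) • (S.E.map Complex.ofReal *ᵥ x) := by
  unfold IsRightEigen at hx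
  rw [pencil, Matrix.sub_mulVec, Matrix.smul_mulVec, hx, sub_smul]

theorem IsLeftEigen.vecMul_pencil {lam : ℂ} {y : Fin n → ℂ} (hy : S.IsLeftEigen lam y) (s : ℂ) :
    y ᵥ* S.pencil s = (s - lam) • (y ᵥ* S.E.map Complex.ofReal) := by
  unfold IsLeftEigen at hy
  rw [pencil, Matrix.vecMul_sub, Matrix.vecMul_smul, hy, sub_smul]

theorem IsRightEigen.resolvent_mulVec {lam : ℂ} {x : Fin n → ℂ} (hx : S.IsRightEigen lam x) {s : ℂ}
    (hs : IsUnit (S.pencil s).det) :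
    (S.pencil s)⁻¹ *ᵥ (S.E.map Complex.ofReal *ᵥ x) = (s - lam)⁻¹ • x := by
  have h1 : (s - lam) • ((S.pencil s)⁻¹ *ᵥ (S.E.map Complex.ofReal *ᵥ x)) = x := by
    rw [← Matrix.mulVec_smul, ← hx.pencil_mulVec, Matrix.mulVec_mulVec,
      Matrix.nonsing_inv_mul _ hs, Matrix.one_mulVec]
  -- At `s = lam` the invertible pencil annihilates `x`, so `x = 0` and both sides vanish.
  by_cases h : s - lam = 0
  · rw [h, zero_smul] at h1
    simp [← h1]
  · conv_rhs => rw [← h1]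
    rw [smul_smul, inv_mul_cancel₀ h, one_smul]

theorem IsLeftEigen.vecMul_resolvent {lam : ℂ} {y : Fin n → ℂ} (hy : S.IsLeftEigen lam y) {s : ℂ}
    (hs : IsUnit (S.pencil s).det) :
    (y ᵥ* S.E.map Complex.ofReal) ᵥ* (S.pencil s)⁻¹ = (s - lam)⁻¹ • y := by
  have h1 : (s - lam) • ((y ᵥ* S.E.map Complex.ofReal) ᵥ* (S.pencil s)⁻¹) = y := by
    rw [← Matrix.smul_vecMul, ← hy.vecMul_pencil, Matrix.vecMul_vecMul,
      Matrix.mul_nonsing_inv _ hs, Matrix.vecMul_one]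
  by_cases h : s - lam = 0
  · rw [h, zero_smul] at h1
    simp [← h1]
  · conv_rhs => rw [← h1]
    rw [smul_smul, inv_mul_cancel₀ h, one_smul]

theorem map_mulVec_conj {a b : ℕ} (M : Matrix (Fin a) (Fin b) ℝ) (x : Fin b → ℂ) :
    M.map Complex.ofReal *ᵥ (star x) = star (M.map Complex.ofReal *ᵥ x) := by
  ext i
  simp [Matrix.mulVec, dotProduct]

theorem conj_vecMul_map {a b : ℕ} (M : Matrix (Fin a) (Fin b) ℝ) (y : Fin a → ℂ) :
    (star y) ᵥ* M.map Complex.ofReal = star (y ᵥ* M.map Complex.ofReal) := by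
  ext i
  simp [Matrix.vecMul, dotProduct]

theorem IsRightEigen.conj {lam : ℂ} {x : Fin n → ℂ} (hx : S.IsRightEigen lam x) :
    S.IsRightEigen (conj lam) (star x) := by
  unfold IsRightEigen at *
  rw [map_mulVec_conj, map_mulVec_conj, hx, star_smul]
  rfl

theorem IsLeftEigen.conj {lam : ℂ} {y : Fin n → ℂ} (hy : S.IsLeftEigen lam y) :
    S.IsLeftEigen (conj lam) (star y) := by
  unfold IsLeftEigen at *
  rw [conj_vecMul_map, conj_vecMul_map, hy, star_smul]
  rfl

/-- A pencil with distinct eigenvalues has biorthogonal bases of left and right eigenvectors. -/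
theorem IsStable.exists_eigenvectors (hS : S.IsStable) {μ : Fin n → ℂ}
    (hμ : Function.Injective μ) (hdet : ∀ i, (S.pencil (μ i)).det = 0) :
    ∃ x y : Fin n → Fin n → ℂ, (∀ i, S.IsRightEigen (μ i) (x i)) ∧
      (∀ i, S.IsLeftEigen (μ i) (y i)) ∧
      (∀ i, y i ⬝ᵥ (S.E.map Complex.ofReal *ᵥ x i) = 1) ∧
      (∀ s, (∀ i, s ≠ μ i) → IsUnit (S.pencil s).det ∧
        (S.pencil s)⁻¹ = ∑ i, (s - μ i)⁻¹ • Matrix.vecMulVec (x i) (y i)) := by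
  set E := S.E.map Complex.ofReal with hE
  set A := S.A.map Complex.ofReal with hA
  have hEu : IsUnit E.det := by
    have h1 := RingHom.map_det Complex.ofRealHom S.E
    rw [RingHom.mapMatrix_apply] at h1
    have h2 : E.det = ((S.E.det : ℝ) : ℂ) := h1.symm
    rw [h2, isUnit_iff_ne_zero]
    exact_mod_cast hS.isUnit_det.ne_zero
  choose x hx0 hx using fun i => Matrix.exists_mulVec_eq_zero_iff.2 (hdet i)
  have hxE : ∀ i, A *ᵥ x i = μ i • (E *ᵥ x i) := fun i => by
    have h1 := hx i
    rw [pencil, Matrix.sub_mulVec, Matrix.smul_mulVec, sub_eq_zero] at h1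
    exact h1.symm
  have hlin : LinearIndependent ℂ x := by
    refine Module.End.eigenvectors_linearIndependent' (Matrix.toLin' (E⁻¹ * A)) μ hμ x fun i => ?_
    refine ⟨Module.End.mem_eigenspace_iff.2 ?_, hx0 i⟩
    rw [Matrix.toLin'_apply, ← Matrix.mulVec_mulVec, hxE, Matrix.mulVec_smul,
      Matrix.mulVec_mulVec, Matrix.nonsing_inv_mul _ hEu, Matrix.one_mulVec]
  set X : Matrix (Fin n) (Fin n) ℂ := (Matrix.of x)ᵀ with hX
  have hXu : IsUnit X.det := by
    rw [hX, Matrix.det_transpose, ← Matrix.isUnit_iff_isUnit_det]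
    exact Matrix.linearIndependent_rows_iff_isUnit.1 hlin
  have hXcol : ∀ (M : Matrix (Fin n) (Fin n) ℂ) (a i : Fin n), (M * X) a i = (M *ᵥ x i) a :=
    fun M a i => rfl
  have hAX : A * X = E * X * Matrix.diagonal μ := by
    ext a i
    rw [Matrix.mul_diagonal, hXcol, hXcol, hxE, Pi.smul_apply, smul_eq_mul, mul_comm]
  -- With right eigenvectors as the columns of `X`, the rows of this inverse are left eigenvectors,
  -- already normalised against `E X`.
  set Y : Matrix (Fin n) (Fin n) ℂ := (E * X)⁻¹ with hY
  have hEXu : IsUnit (E * X).det := by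
    rw [Matrix.det_mul]
    exact hEu.mul hXu
  have hYEX : Y * (E * X) = 1 := Matrix.nonsing_inv_mul _ hEXu
  have hEXY : E * X * Y = 1 := Matrix.mul_nonsing_inv _ hEXu
  have hXYE : X * (Y * E) = 1 := by
    rw [mul_eq_one_comm, Matrix.mul_assoc]
    exact hYEX
  have hYA : Y * A = Matrix.diagonal μ * (Y * E) := by
    calc Y * A = Y * (A * X) * (Y * E) := by
          rw [Matrix.mul_assoc Y, Matrix.mul_assoc A, hXYE, Matrix.mul_one]
      _ = Y * (E * X) * Matrix.diagonal μ * (Y * E) := by rw [hAX]; simp only [Matrix.mul_assoc]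
      _ = _ := by rw [hYEX, Matrix.one_mul]
  have hYrow : ∀ (M : Matrix (Fin n) (Fin n) ℂ) (i a : Fin n), (Y * M) i a = (Y i ᵥ* M) a :=
    fun M i a => rfl
  refine ⟨x, fun i => Y i, hxE, fun i => ?_, fun i => ?_, fun s hs => ?_⟩
  · ext a
    rw [← hYrow, hYA, Matrix.diagonal_mul, hYrow]
    rfl
  · have h1 := congrFun (congrFun hYEX i) i
    rw [Matrix.one_apply_eq] at h1
    exact h1
  · have hPX : S.pencil s * X = E * X * Matrix.diagonal fun i => s - μ i := by
      ext a i
      rw [Matrix.mul_diagonal, hXcol, hXcol, IsRightEigen.pencil_mulVec (lam := μ i) (hxE i),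
        Pi.smul_apply, smul_eq_mul, mul_comm]
    have hPinv : S.pencil s * (X * Matrix.diagonal (fun i => (s - μ i)⁻¹) * Y) = 1 := by
      rw [← Matrix.mul_assoc, ← Matrix.mul_assoc, hPX, Matrix.mul_assoc (E * X),
        Matrix.diagonal_mul_diagonal]
      have : (fun i => (s - μ i) * (s - μ i)⁻¹) = fun _ => (1 : ℂ) := by
        funext i
        exact mul_inv_cancel₀ (sub_ne_zero.2 (hs i))
      rw [this, Matrix.diagonal_one, Matrix.mul_one, hEXY]
    refine ⟨Matrix.isUnit_det_of_right_inverse hPinv, ?_⟩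
    rw [Matrix.inv_eq_right_inv hPinv]
    ext a b
    rw [Matrix.mul_apply, Matrix.sum_apply]
    refine Finset.sum_congr rfl fun i _ => ?_
    rw [Matrix.mul_diagonal, Matrix.smul_apply, Matrix.vecMulVec_apply, smul_eq_mul]
    simp only [hX, Matrix.transpose_apply, Matrix.of_apply]
    ring

end LTISystem

/-- Multiply by `s - μ k` and let `s → μ k` away from the poles: only the residue at `μ k` survives.
-/
theorem eq_zero_of_sum_simple_poles_eq_zero {ι : Type*} [Fintype ι] {μ : ι → ℂ}
    (hμ : Function.Injective μ) {ρ : ι → ℂ}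
    (h : ∀ s, (∀ i, s ≠ μ i) → ∑ i, (s - μ i)⁻¹ * ρ i = 0) (k : ι) : ρ k = 0 := by
  classical
  have hne : ∀ᶠ s in 𝓝[≠] μ k, ∀ i, s ≠ μ i := by
    rw [eventually_all]
    intro i
    by_cases hik : i = k
    · rw [hik]
      exact self_mem_nhdsWithin
    · exact (isOpen_ne.eventually_mem (hμ.ne (Ne.symm hik))).filter_mono nhdsWithin_le_nhds
  have hterm : ∀ i, Tendsto (fun s => (s - μ k) * ((s - μ i)⁻¹ * ρ i)) (𝓝[≠] μ k)
      (𝓝 (if i = k then ρ k else 0)) := by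
    intro i
    by_cases hik : i = k
    · rw [if_pos hik, hik]
      refine tendsto_const_nhds.congr' ?_
      filter_upwards [self_mem_nhdsWithin] with s hs
      rw [← mul_assoc, mul_inv_cancel₀ (sub_ne_zero.2 hs), one_mul]
    · rw [if_neg hik]
      have hk : μ k - μ i ≠ 0 := sub_ne_zero.2 (hμ.ne (Ne.symm hik))
      have hc : ContinuousAt (fun s => (s - μ k) * ((s - μ i)⁻¹ * ρ i)) (μ k) :=
        (continuousAt_id.sub continuousAt_const).mul
          (((continuousAt_id.sub continuousAt_const).inv₀ hk).mul continuousAt_const)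
      have := hc.tendsto
      simp only [sub_self, zero_mul] at this
      exact this.mono_left nhdsWithin_le_nhds
  have hsum := tendsto_finsetSum Finset.univ fun i _ => hterm i
  rw [Finset.sum_ite_eq' Finset.univ k, if_pos (Finset.mem_univ k)] at hsum
  refine tendsto_nhds_unique hsum (tendsto_const_nhds.congr' ?_)
  filter_upwards [hne] with s hs
  rw [← Finset.mul_sum, h s hs, mul_zero]

/-! ### Interpolation along eigenvectors, and vanishing residues. -/

section Interpolation

variable {m p r : ℕ} {H : ℂ → Matrix (Fin p) (Fin m) ℂ} {S : LTISystem r m p}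

/-- The perturbation `(E x) vᵀ` of `B` produces the direction `(s - λ)⁻¹ (C x) vᵀ`, because the
resolvent maps `E x` to `(s - λ)⁻¹ x`; `v` is arbitrary. -/
theorem IsBestH2Approx.vecMul_error_eq_zero (hbest : IsBestH2Approx H S) (hH : MemH2 H)
    (hreal : IsRealTransfer H) {lam : ℂ} (hlam : lam.re < 0) {x : Fin r → ℂ}
    (hx : S.IsRightEigen lam x) :
    (S.C.map Complex.ofReal *ᵥ x) ᵥ* (H (-lam) - S.transfer (-lam)) = 0 := by
  refine dotProduct_eq_zero _ fun v => ?_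
  have h1 := hbest.axisPairing_input hH hreal
    (Matrix.vecMulVec (S.E.map Complex.ofReal *ᵥ x) v)
  rw [axisPairing_simple_pole (hH.sub hbest.1.memH2) hlam (S.C.map Complex.ofReal *ᵥ x) v
    fun ω => ?_] at h1
  · rw [← Matrix.dotProduct_mulVec]
    simpa [Real.pi_ne_zero] using h1
  · rw [Matrix.mul_vecMulVec, ← Matrix.mulVec_mulVec,
      hx.resolvent_mulVec (hbest.1.isUnit_pencil_det (by simp)), Matrix.mulVec_smul,
      Matrix.smul_vecMulVec]

theorem IsBestH2Approx.error_mulVec_eq_zero (hbest : IsBestH2Approx H S) (hH : MemH2 H)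
    (hreal : IsRealTransfer H) {lam : ℂ} (hlam : lam.re < 0) {y : Fin r → ℂ}
    (hy : S.IsLeftEigen lam y) :
    (H (-lam) - S.transfer (-lam)) *ᵥ (y ᵥ* S.B.map Complex.ofReal) = 0 := by
  refine dotProduct_eq_zero _ fun u => ?_
  have h1 := hbest.axisPairing_output hH hreal
    (Matrix.vecMulVec u (y ᵥ* S.E.map Complex.ofReal))
  rw [axisPairing_simple_pole (hH.sub hbest.1.memH2) hlam u (y ᵥ* S.B.map Complex.ofReal)
    fun ω => ?_] at h1
  · rw [dotProduct_comm]
    simpa [Real.pi_ne_zero] using h1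
  · rw [Matrix.vecMulVec_mul, ← Matrix.vecMul_vecMul,
      hy.vecMul_resolvent (hbest.1.isUnit_pencil_det (by simp)), Matrix.smul_vecMul,
      Matrix.vecMulVec_smul]

/-- Perturbing `A` by `(E x)(y E)` applies the resolvent on both sides, which creates the double
pole and hence the derivative. -/
theorem IsBestH2Approx.dotProduct_deriv_error_eq_zero (hbest : IsBestH2Approx H S)
    (hH : MemH2 H) (hreal : IsRealTransfer H) {lam : ℂ} (hlam : lam.re < 0) {x y : Fin r → ℂ}
    (hx : S.IsRightEigen lam x) (hy : S.IsLeftEigen lam y) :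
    (S.C.map Complex.ofReal *ᵥ x) ⬝ᵥ (matrixDeriv (fun s => H s - S.transfer s) (-lam) *ᵥ
      (y ᵥ* S.B.map Complex.ofReal)) = 0 := by
  have h1 := hbest.axisPairing_state hH hreal
    (Matrix.vecMulVec (S.E.map Complex.ofReal *ᵥ x) (y ᵥ* S.E.map Complex.ofReal))
  rw [axisPairing_double_pole (hH.sub hbest.1.memH2) hlam (S.C.map Complex.ofReal *ᵥ x)
    (y ᵥ* S.B.map Complex.ofReal) fun ω => ?_] at h1
  · simpa [Real.pi_ne_zero] using h1
  · have hu := hbest.1.isUnit_pencil_det (s := Complex.I * (ω : ℂ)) (by simp)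
    rw [Matrix.mul_vecMulVec, ← Matrix.mulVec_mulVec, hx.resolvent_mulVec hu,
      Matrix.vecMulVec_mul, ← Matrix.vecMul_vecMul, hy.vecMul_resolvent hu, Matrix.mulVec_smul,
      Matrix.smul_vecMul, Matrix.smul_vecMulVec, Matrix.vecMulVec_smul, smul_smul, ← mul_inv, sq]

theorem matrixDeriv_error (hH : MemH2 H) (hS : S.IsStable) {z : ℂ} (hz : 0 < z.re) :
    matrixDeriv (fun s => H s - S.transfer s) z = matrixDeriv H z - matrixDeriv S.transfer z := by
  have hopen : IsOpen {s : ℂ | 0 < s.re} := isOpen_lt continuous_const Complex.continuous_re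
  ext i j
  exact deriv_fun_sub ((hH.differentiableOn i j).differentiableAt (hopen.mem_nhds hz))
    (hS.differentiableAt hz.le i j)

theorem map_re_map_ofReal (Z : Matrix (Fin p) (Fin m) ℂ) :
    (Z.map Complex.re).map Complex.ofReal = (1 / 2 : ℂ) • (Z + Z.map (starRingEnd ℂ)) := by
  ext i j
  simp only [Matrix.map_apply, Matrix.smul_apply, Matrix.add_apply, smul_eq_mul, Complex.add_conj]
  push_cast
  ring

theorem vecMulVec_map_conj (u : Fin p → ℂ) (w : Fin m → ℂ) :
    (Matrix.vecMulVec u w).map (starRingEnd ℂ) = Matrix.vecMulVec (star u) (star w) := by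
  ext i j
  simp [Matrix.vecMulVec_apply]

/-- A map that vanishes on all `v + α v̄` is zero. -/
theorem mulVec_eq_zero_of_forall_add_star {M : Matrix (Fin p) (Fin m) ℂ} {α : ℂ}
    (h : ∀ v, M *ᵥ (v + α • star v) = 0) (v : Fin m → ℂ) : M *ᵥ v = 0 := by
  have h1 := h v
  have h2 := h (Complex.I • v)
  -- Replacing `v` by `i v` and multiplying by `-i` keeps the linear part and flips the sign of the
  -- conjugate-linear part, so averaging removes it.
  have h3 : v = (1 / 2 : ℂ) • ((v + α • star v) -
      Complex.I • (Complex.I • v + α • star (Complex.I • v))) := by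
    ext i
    simp only [Pi.smul_apply, Pi.sub_apply, Pi.add_apply, Pi.star_apply, smul_eq_mul, star_mul',
      Complex.star_def, Complex.conj_I]
    linear_combination (1 / 2 * v i - 1 / 2 * α * conj (v i)) * Complex.I_sq
  rw [h3, Matrix.mulVec_smul, Matrix.mulVec_sub, Matrix.mulVec_smul, h1, h2]
  simp

/-- If an eigenvector is unobservable, the input matrix can be changed without changing the
transfer function, so that the error vanishes at the mirror image of the pole. -/
theorem IsBestH2Approx.error_eq_zero_of_unobservable (hbest : IsBestH2Approx H S)
    (hH : MemH2 H) (hreal : IsRealTransfer H) {lam : ℂ} (hlam : lam.re < 0) {x y : Fin r → ℂ}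
    (hx : S.IsRightEigen lam x) (hy : S.IsLeftEigen lam y)
    (hxy : y ⬝ᵥ (S.E.map Complex.ofReal *ᵥ x) = 1) (hC : S.C.map Complex.ofReal *ᵥ x = 0) :
    H (-lam) - S.transfer (-lam) = 0 := by
  set Ec := S.E.map Complex.ofReal with hEc
  have hC' : S.C.map Complex.ofReal *ᵥ (star x) = 0 := by
    rw [LTISystem.map_mulVec_conj, hC, star_zero]
  have key : ∀ v, (H (-lam) - S.transfer (-lam)) *ᵥ (v + (y ⬝ᵥ (Ec *ᵥ star x)) • star v) = 0 := by
    intro v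
    -- A real matrix whose columns lie in the span of `x` and its conjugate, both in the kernel of
    -- `C`; adding `E D` to `B` therefore leaves the transfer function alone. The conjugate half
    -- survives in `y B`, since `y` need not annihilate `E x̄`, for instance when `λ` is real.
    set D := (Matrix.vecMulVec x v).map Complex.re with hD
    have hDc : D.map Complex.ofReal =
        (1 / 2 : ℂ) • (Matrix.vecMulVec x v + Matrix.vecMulVec (star x) (star v)) := by
      rw [hD, map_re_map_ofReal, vecMulVec_map_conj]
    have hB : (S.B + S.E * D).map Complex.ofReal =
        S.B.map Complex.ofReal + Ec * D.map Complex.ofReal := by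
      have h1 : (S.E * D).map Complex.ofReal = Ec * D.map Complex.ofReal :=
        Matrix.map_mul (f := Complex.ofRealHom)
      rw [← h1]
      ext i j
      simp
    let T : LTISystem r m p := ⟨S.E, S.A, S.B + S.E * D, S.C⟩
    have hT : T.transfer = S.transfer := by
      funext s
      have h2 : T.transfer s = S.C.map Complex.ofReal * (S.pencil s)⁻¹ *
          (S.B + S.E * D).map Complex.ofReal := rfl
      rw [h2, hB, Matrix.mul_add, LTISystem.transfer, add_eq_left]
      by_cases hu : IsUnit (S.pencil s).det
      · rw [hDc, Matrix.mul_smul, Matrix.mul_smul, Matrix.mul_add, Matrix.mul_add,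
          Matrix.mul_vecMulVec, Matrix.mul_vecMulVec, Matrix.mul_vecMulVec, Matrix.mul_vecMulVec,
          ← Matrix.mulVec_mulVec, ← Matrix.mulVec_mulVec, hx.resolvent_mulVec hu,
          hx.conj.resolvent_mulVec hu, Matrix.mulVec_smul, Matrix.mulVec_smul, hC, hC']
        simp
      -- At an eigenvalue of the pencil the inverse is `0` by convention, so the added term still
      -- vanishes.
      · rw [Matrix.nonsing_inv_apply_not_isUnit _ hu]
        simp
    have hTbest : IsBestH2Approx H T := by
      refine ⟨hbest.1.of_eq _ _, ?_⟩
      rw [hT]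
      exact hbest.2
    -- Both systems are best approximations with the same error, which thus annihilates `y B` for
    -- the old and the new `B`, hence their difference.
    have h3 := hTbest.error_mulVec_eq_zero hH hreal hlam (y := y) hy
    have h4 := hbest.error_mulVec_eq_zero hH hreal hlam hy
    rw [hT] at h3
    have h5 : y ᵥ* T.B.map Complex.ofReal = y ᵥ* S.B.map Complex.ofReal +
        (1 / 2 : ℂ) • (v + (y ⬝ᵥ (Ec *ᵥ star x)) • star v) := by
      change y ᵥ* (S.B + S.E * D).map Complex.ofReal = _
      rw [hB, Matrix.vecMul_add, hDc, Matrix.mul_smul, Matrix.mul_add, Matrix.mul_vecMulVec,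
        Matrix.mul_vecMulVec, Matrix.vecMul_smul, Matrix.vecMul_add, Matrix.vecMul_vecMulVec,
        Matrix.vecMul_vecMulVec, hxy, one_smul]
    rw [h5, Matrix.mulVec_add, h4, zero_add, Matrix.mulVec_smul] at h3
    simpa using h3
  refine Matrix.ext_of_mulVec_single fun j => ?_
  rw [mulVec_eq_zero_of_forall_add_star key, Matrix.zero_mulVec]

/-- If an eigenvector is unreachable, the output matrix can be changed without changing the
transfer function, so that the error vanishes at the mirror image of the pole. -/
theorem IsBestH2Approx.error_eq_zero_of_unreachable (hbest : IsBestH2Approx H S)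
    (hH : MemH2 H) (hreal : IsRealTransfer H) {lam : ℂ} (hlam : lam.re < 0) {x y : Fin r → ℂ}
    (hx : S.IsRightEigen lam x) (hy : S.IsLeftEigen lam y)
    (hxy : y ⬝ᵥ (S.E.map Complex.ofReal *ᵥ x) = 1) (hB : y ᵥ* S.B.map Complex.ofReal = 0) :
    H (-lam) - S.transfer (-lam) = 0 := by
  set Ec := S.E.map Complex.ofReal with hEc
  have hB' : (star y) ᵥ* S.B.map Complex.ofReal = 0 := by
    rw [LTISystem.conj_vecMul_map, hB, star_zero]
  have key : ∀ u, (H (-lam) - S.transfer (-lam))ᵀ *ᵥ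
      (u + (star y ⬝ᵥ (Ec *ᵥ x)) • star u) = 0 := by
    intro u
    -- The dual choice: the rows of `D` lie in the span of `y` and its conjugate, both of which
    -- annihilate `B`.
    set D := (Matrix.vecMulVec u y).map Complex.re with hD
    have hDc : D.map Complex.ofReal =
        (1 / 2 : ℂ) • (Matrix.vecMulVec u y + Matrix.vecMulVec (star u) (star y)) := by
      rw [hD, map_re_map_ofReal, vecMulVec_map_conj]
    have hC : (S.C + D * S.E).map Complex.ofReal =
        S.C.map Complex.ofReal + D.map Complex.ofReal * Ec := by
      have h1 : (D * S.E).map Complex.ofReal = D.map Complex.ofReal * Ec :=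
        Matrix.map_mul (f := Complex.ofRealHom)
      rw [← h1]
      ext i j
      simp
    let T : LTISystem r m p := ⟨S.E, S.A, S.B, S.C + D * S.E⟩
    have hT : T.transfer = S.transfer := by
      funext s
      have h2 : T.transfer s = (S.C + D * S.E).map Complex.ofReal * (S.pencil s)⁻¹ *
          S.B.map Complex.ofReal := rfl
      rw [h2, hC, Matrix.add_mul, Matrix.add_mul, LTISystem.transfer, add_eq_left]
      by_cases hu : IsUnit (S.pencil s).det
      · rw [hDc, Matrix.smul_mul, Matrix.smul_mul, Matrix.smul_mul, Matrix.add_mul,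
          Matrix.add_mul, Matrix.add_mul, Matrix.vecMulVec_mul, Matrix.vecMulVec_mul,
          Matrix.vecMulVec_mul, Matrix.vecMulVec_mul, Matrix.vecMulVec_mul, Matrix.vecMulVec_mul,
          hy.vecMul_resolvent hu, hy.conj.vecMul_resolvent hu, Matrix.smul_vecMul,
          Matrix.smul_vecMul, hB, hB']
        ext a d
        simp [Matrix.vecMulVec_apply]
      · rw [Matrix.nonsing_inv_apply_not_isUnit _ hu]
        simp
    have hTbest : IsBestH2Approx H T := by
      refine ⟨hbest.1.of_eq _ _, ?_⟩
      rw [hT]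
      exact hbest.2
    have h3 := hTbest.vecMul_error_eq_zero hH hreal hlam (x := x) hx
    have h4 := hbest.vecMul_error_eq_zero hH hreal hlam hx
    rw [hT] at h3
    have h5 : T.C.map Complex.ofReal *ᵥ x = S.C.map Complex.ofReal *ᵥ x +
        (1 / 2 : ℂ) • (u + (star y ⬝ᵥ (Ec *ᵥ x)) • star u) := by
      change (S.C + D * S.E).map Complex.ofReal *ᵥ x = _
      rw [hC, Matrix.add_mulVec, hDc, ← Matrix.mulVec_mulVec, Matrix.smul_mulVec,
        Matrix.add_mulVec, Matrix.vecMulVec_mulVec, Matrix.vecMulVec_mulVec, hxy]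
      simp
    rw [h5, Matrix.add_vecMul, h4, zero_add, Matrix.smul_vecMul] at h3
    rw [Matrix.mulVec_transpose]
    simpa using h3
  refine Matrix.transpose_injective (Matrix.ext_of_mulVec_single fun j => ?_)
  rw [mulVec_eq_zero_of_forall_add_star key, Matrix.transpose_zero, Matrix.zero_mulVec]

theorem vecMulVec_eq_zero_iff {u : Fin p → ℂ} {w : Fin m → ℂ} :
    Matrix.vecMulVec u w = 0 ↔ u = 0 ∨ w = 0 := by
  simp only [← Matrix.ext_iff, Matrix.vecMulVec_apply, Matrix.zero_apply, mul_eq_zero,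
    funext_iff, Pi.zero_apply, forall_or_left, forall_or_right]

theorem exists_smul_eq_of_vecMulVec_eq {c u : Fin p → ℂ} {b w : Fin m → ℂ}
    (h : Matrix.vecMulVec c b = Matrix.vecMulVec u w) (h0 : Matrix.vecMulVec c b ≠ 0) :
    (∃ α : ℂ, c = α • u) ∧ ∃ β : ℂ, b = β • w := by
  have h1 : ∀ i j, c i * b j = u i * w j := fun i j => congrFun (congrFun h i) j
  obtain ⟨i, j, hij⟩ : ∃ i j, c i * b j ≠ 0 := by
    by_contra! hall
    exact h0 (Matrix.ext hall)
  have hc : c i ≠ 0 := left_ne_zero_of_mul hij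
  have hb : b j ≠ 0 := right_ne_zero_of_mul hij
  refine ⟨⟨w j / b j, funext fun a => ?_⟩, ⟨u i / c i, funext fun a => ?_⟩⟩
  · rw [Pi.smul_apply, smul_eq_mul]
    field_simp
    linear_combination h1 a j
  · rw [Pi.smul_apply, smul_eq_mul]
    field_simp
    linear_combination h1 i a

end Interpolation

/-! ### The interpolation conditions. -/

theorem mainTheorem1 {r m p : ℕ}
    (H : ℂ → Matrix (Fin p) (Fin m) ℂ) (hH : MemH2 H) (hreal : IsRealTransfer H)
    (Hr : LTISystem r m p) (hbest : IsBestH2Approx H Hr)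
    (c : Fin r → Fin p → ℂ) (b : Fin r → Fin m → ℂ) (μ : Fin r → ℂ)
    (hdistinct : Function.Injective μ)
    (hpole : ∀ i, (Hr.pencil (μ i)).det = 0)
    (hexpansion : ∀ s : ℂ, (Hr.pencil s).det ≠ 0 →
      Hr.transfer s = ∑ i, (s - μ i)⁻¹ • Matrix.vecMulVec (c i) (b i)) :
    ∀ k : Fin r,
      H (-μ k) *ᵥ b k = Hr.transfer (-μ k) *ᵥ b k ∧
      c k ᵥ* H (-μ k) = c k ᵥ* Hr.transfer (-μ k) ∧
      c k ⬝ᵥ (matrixDeriv H (-μ k) *ᵥ b k) = c k ⬝ᵥ (matrixDeriv Hr.transfer (-μ k) *ᵥ b k) := by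
  intro k
  obtain ⟨x, y, hx, hy, hxy, hres⟩ := hbest.1.exists_eigenvectors hdistinct hpole
  have hlam : (μ k).re < 0 := hbest.1.re_neg _ (hpole k)
  have hz : 0 < (-μ k).re := by simpa using hlam
  set u := Hr.C.map Complex.ofReal *ᵥ x k with hu
  set w := y k ᵥ* Hr.B.map Complex.ofReal with hw
  -- The given expansion and the one from the eigenvectors agree off the poles, so their residues
  -- agree.
  have hresidue : Matrix.vecMulVec (c k) (b k) = Matrix.vecMulVec u w := by
    ext a d
    rw [← sub_eq_zero]
    refine eq_zero_of_sum_simple_poles_eq_zero hdistinct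
      (ρ := fun i => Matrix.vecMulVec (c i) (b i) a d - Matrix.vecMulVec
        (Hr.C.map Complex.ofReal *ᵥ x i) (y i ᵥ* Hr.B.map Complex.ofReal) a d) (fun s hs => ?_) k
    obtain ⟨hdet, hinv⟩ := hres s hs
    have h1 := hexpansion s hdet.ne_zero
    rw [LTISystem.transfer, hinv, Matrix.mul_sum, Matrix.sum_mul] at h1
    simp only [Matrix.mul_smul, Matrix.smul_mul, Matrix.mul_vecMulVec, Matrix.vecMulVec_mul] at h1
    have h2 := congrFun (congrFun h1 a) d
    simp only [Matrix.sum_apply, Matrix.smul_apply, smul_eq_mul] at h2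
    simp only [mul_sub, Finset.sum_sub_distrib, h2, sub_self]
  have hderiv := matrixDeriv_error hH hbest.1 hz
  rw [← sub_eq_zero, ← Matrix.sub_mulVec, ← sub_eq_zero (a := c k ᵥ* _), ← Matrix.vecMul_sub,
    ← sub_eq_zero (a := c k ⬝ᵥ _), ← dotProduct_sub, ← Matrix.sub_mulVec, ← hderiv]
  -- A zero residue kills only one of `c k`, `b k`; the one-sided condition on the other needs the
  -- whole error to vanish at `-μ k`. The derivative condition is then trivial.
  by_cases h0 : Matrix.vecMulVec (c k) (b k) = 0
  · have hM : H (-μ k) - Hr.transfer (-μ k) = 0 := by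
      rcases vecMulVec_eq_zero_iff.1 (hresidue.symm.trans h0) with h | h
      · exact hbest.error_eq_zero_of_unobservable hH hreal hlam (hx k) (hy k) (hxy k) h
      · exact hbest.error_eq_zero_of_unreachable hH hreal hlam (hx k) (hy k) (hxy k) h
    refine ⟨by rw [hM, Matrix.zero_mulVec], by rw [hM, Matrix.vecMul_zero], ?_⟩
    rcases vecMulVec_eq_zero_iff.1 h0 with h | h
    · rw [h, zero_dotProduct]
    · rw [h, Matrix.mulVec_zero, dotProduct_zero]
  · obtain ⟨⟨α, hα⟩, β, hβ⟩ := exists_smul_eq_of_vecMulVec_eq hresidue h0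
    rw [hα, hβ, Matrix.mulVec_smul, Matrix.smul_vecMul, Matrix.mulVec_smul, dotProduct_smul,
      smul_dotProduct, hu, hw, hbest.error_mulVec_eq_zero hH hreal hlam (hy k),
      hbest.vecMul_error_eq_zero hH hreal hlam (hx k),
      hbest.dotProduct_deriv_error_eq_zero hH hreal hlam (hx k) (hy k)]
    simp
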